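/- Let $d\ge 1$, let $D\subset\mathbb R^d$ be a bounded convex domain, and let $S\subset\mathbb R^d$ be the unit sphere with its rotation-invariant measure $\mathrm ds$ normalized by $\int_S\mathrm ds=1$. Let $n(x)$ denote the outward unit normal of $D$, defined at those boundary points (almost all of $\partial D$) where there is a unique one, and put $\Gamma_\pm=\{(x,s)\in\partial D\times S:\ \pm\, s\cdot n(x)>0\}$. Let $$H(D\times S)=\{v\in L_2(D\times S):\ s\cdot\nabla v\in L_2(D\times S)\},\qquad \|v\|_H^2=\|v\|_{L_2}^2+\|s\cdot\nabla v\|_{L_2}^2,$$ where $s\cdot\nabla$ is the distributional derivative in $x$ along $s$, and let $H_{0,\pm}(D\times S)$ be the closure in $H(D\times S)$ of $\{v\in C^1(\overline{D\times S}):\ v|_{\Gamma_\pm}=0\}$. Let $\sigma:D\times S\to\mathbb R$ and $K:D\times S\times S\to\mathbb R$ be measurable with $0\le\sigma\le\sigma_{\max}<\infty$ a.e., $K\ge 0$ a.e., and $K\in L_\infty(D;L_2(S\times S))$ with norm at most $M_K<\infty$, and let $(\mathcal K u)(x,s)=\int_S K(x,s',s)\,u(x,s')\,\mathrm ds'$.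 Consider the two variational formulations (F1) $U=L_2(D\times S)$, $V=H_{0,+}(D\times S)$, $\displaystyle b(u,v)=\int_{D\times S}u\,(\sigma v-s\cdot\nabla v)\,\mathrm dx\,\mathrm ds-\int_{D\times S}(\mathcal K u)\,v\,\mathrm dx\,\mathrm ds$; (F2) $U=H_{0,-}(D\times S)$, $V=L_2(D\times S)$, $\displaystyle b(u,v)=\int_{D\times S}(s\cdot\nabla u+\sigma u)\,v\,\mathrm dx\,\mathrm ds-\int_{D\times S}(\mathcal K u)\,v\,\mathrm dx\,\mathrm ds$. Assume that $\mathcal B=s\cdot\nabla+\sigma-\mathcal K$ is accretive: for some $\alpha>0$, $(\mathcal B v,v)_{L_2(D\times S)}\ge\alpha\|v\|_{L_2(D\times S)}^2$ for all $v\in H_{0,-}(D\times S)$. Then, for each of the two formulations (F1), (F2) and every $f\in V'$, there is exactly one $u\in U$ with $b(u,v)=\langle f,v\rangle$ for all $v\in V$, and $\|u\|_U\le C\|f\|_{V'}$. The operator $\mathcal B:U\to V'$ defined by $\langle\mathcal B u,v\rangle=b(u,v)$ is a linear norm-isomorphism of $U$ onto $V'$, with finite condition number $\|\mathcal B\|_{\mathcal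 L(U,V')}\|\mathcal B^{-1}\|_{\mathcal L(V',U)}\le\kappa$. The constants $C$ and $\kappa$ depend only on $\alpha$, $\sigma_{\max}$ and $M_K$. -/

import Mathlib

open MeasureTheory Set
open scoped NNReal ENNReal ContDiff RealInnerProductSpace

noncomputable section

namespace RadTrans

/-- Euclidean space `ℝᵈ`. -/
abbrev E (d : ℕ) := EuclideanSpace ℝ (Fin d)

/-- The unit sphere of directions in `ℝᵈ`. -/
abbrev Sph (d : ℕ) := Metric.sphere (0 : E d) 1

/-- The rotation-invariant (surface) measure on the unit sphere, normalized to total mass one. -/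
def sphereMeasure (d : ℕ) : Measure (Sph d) :=
  ((volume : Measure (E d)).toSphere univ)⁻¹ • (volume : Measure (E d)).toSphere

instance (d : ℕ) : IsFiniteMeasure (sphereMeasure d) := by
  unfold sphereMeasure
  refine ⟨?_⟩
  rw [Measure.smul_apply, smul_eq_mul]
  exact lt_of_le_of_lt (ENNReal.inv_mul_le_one _) ENNReal.one_lt_top

/-- The measure `dx ds` on the phase space `D × S`, carried by `ℝᵈ × S`. -/
def phaseMeasure {d : ℕ} (D : Set (E d)) : Measure (E d × Sph d) :=
  (volume.restrict D).prod (sphereMeasure d)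

instance {d : ℕ} (D : Set (E d)) : IsFiniteMeasureOnCompacts (phaseMeasure D) := by
  unfold phaseMeasure
  infer_instance

/-- The real Hilbert space `L₂(D × S)`. -/
abbrev L2 {d : ℕ} (D : Set (E d)) := Lp ℝ 2 (phaseMeasure D)

/-- The inclusion `ℝᵈ × S ⊆ ℝᵈ × ℝᵈ`. -/
def amb {d : ℕ} (z : E d × Sph d) : E d × E d := (z.1, (z.2 : E d))

/-- The transport derivative `s · ∇ₓ φ(x, s)`. -/
def transportDeriv {d : ℕ} (φ : E d × E d → ℝ) (z : E d × Sph d) : ℝ :=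
  fderiv ℝ φ (amb z) ((z.2 : E d), 0)

/-- Test functions on `D × S`: restrictions to `D × S` of smooth, compactly supported functions
on `ℝᵈ × ℝᵈ` whose support lies over `D`. -/
def IsTest {d : ℕ} (D : Set (E d)) (φ : E d × E d → ℝ) : Prop :=
  ContDiff ℝ ∞ φ ∧ HasCompactSupport φ ∧ tsupport φ ⊆ D ×ˢ univ

/-- `g = s · ∇ₓ v` in the sense of distributions on `D × S`. -/
def IsWeakTransportDeriv {d : ℕ} (D : Set (E d)) (v g : L2 D) : Prop :=
  ∀ φ : E d × E d → ℝ, IsTest D φ →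
    ∫ z, v z * transportDeriv φ z ∂(phaseMeasure D) = -∫ z, g z * φ (amb z) ∂(phaseMeasure D)

theorem continuous_amb {d : ℕ} : Continuous (amb : E d × Sph d → E d × E d) := by
  unfold amb; fun_prop

theorem isClosedEmbedding_amb {d : ℕ} :
    Topology.IsClosedEmbedding (amb : E d × Sph d → E d × E d) :=
  Topology.IsClosedEmbedding.id.prodMap (Metric.isClosed_sphere.isClosedEmbedding_subtypeVal)

theorem IsTest.memLp {d : ℕ} {D : Set (E d)} {φ : E d × E d → ℝ} (h : IsTest D φ) :
    MemLp (fun z => φ (amb z)) 2 (phaseMeasure D) :=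
  (h.1.continuous.comp continuous_amb).memLp_of_hasCompactSupport
    (h.2.1.comp_isClosedEmbedding isClosedEmbedding_amb)

theorem IsTest.memLp_deriv {d : ℕ} {D : Set (E d)} {φ : E d × E d → ℝ} (h : IsTest D φ) :
    MemLp (transportDeriv φ) 2 (phaseMeasure D) := by
  have hc : Continuous (fderiv ℝ φ) := h.1.continuous_fderiv (by simp)
  have hs : HasCompactSupport (fun z : E d × Sph d => fderiv ℝ φ (amb z)) :=
    (h.2.1.fderiv ℝ).comp_isClosedEmbedding isClosedEmbedding_amb
  have hcont : Continuous (transportDeriv φ) := by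
    unfold transportDeriv
    exact (hc.comp continuous_amb).clm_apply (by fun_prop)
  refine hcont.memLp_of_hasCompactSupport (hs.mono ?_)
  intro z hz hz'
  exact hz (by simp only [transportDeriv]; rw [show fderiv ℝ φ (amb z) = 0 from hz']; rfl)

/-- The space `H(D × S) = {v ∈ L₂(D × S) : s · ∇v ∈ L₂(D × S)}`. An element is recorded as the
pair `(v, s · ∇v)`, so that its norm satisfies `‖v‖²_H = ‖v‖²_{L₂} + ‖s · ∇v‖²_{L₂}`. -/
def H {d : ℕ} (D : Set (E d)) : Submodule ℝ (WithLp 2 (L2 D × L2 D)) where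
  carrier := {p | IsWeakTransportDeriv D p.fst p.snd}
  zero_mem' := by
    intro φ _
    have h0 : ⇑(0 : L2 D) =ᵐ[phaseMeasure D] 0 := Lp.coeFn_zero _ _ _
    have h1 : ∫ z, (0 : L2 D) z * transportDeriv φ z ∂(phaseMeasure D) = 0 :=
      integral_eq_zero_of_ae (by filter_upwards [h0] with z hz; rw [hz]; simp)
    have h2 : ∫ z, (0 : L2 D) z * φ (amb z) ∂(phaseMeasure D) = 0 :=
      integral_eq_zero_of_ae (by filter_upwards [h0] with z hz; rw [hz]; simp)
    simp only [WithLp.zero_fst, WithLp.zero_snd]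
    rw [h1, h2, neg_zero]
  add_mem' := by
    intro p q hp hq φ hφ
    have e1 : ∀ (a b : L2 D) (ψ : E d × Sph d → ℝ), MemLp ψ 2 (phaseMeasure D) →
        ∫ z, (a + b : L2 D) z * ψ z ∂(phaseMeasure D)
          = ∫ z, a z * ψ z ∂(phaseMeasure D) + ∫ z, b z * ψ z ∂(phaseMeasure D) := by
      intro a b ψ hψ
      have ha : Integrable (fun z => a z * ψ z) (phaseMeasure D) :=
        (Lp.memLp a).integrable_mul hψ
      have hb : Integrable (fun z => b z * ψ z) (phaseMeasure D) :=
        (Lp.memLp b).integrable_mul hψ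
      rw [← integral_add ha hb]
      refine integral_congr_ae ?_
      filter_upwards [Lp.coeFn_add a b] with z hz
      rw [hz, Pi.add_apply, add_mul]
    simp only [WithLp.add_fst, WithLp.add_snd]
    rw [e1 _ _ _ hφ.memLp_deriv, e1 _ _ _ hφ.memLp, hp φ hφ, hq φ hφ]
    ring
  smul_mem' := by
    intro c p hp φ hφ
    have e1 : ∀ (a : L2 D) (ψ : E d × Sph d → ℝ),
        ∫ z, (c • a : L2 D) z * ψ z ∂(phaseMeasure D)
          = c * ∫ z, a z * ψ z ∂(phaseMeasure D) := by
      intro a ψ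
      rw [← integral_const_mul]
      refine integral_congr_ae ?_
      filter_upwards [Lp.coeFn_smul c a] with z hz
      rw [hz, Pi.smul_apply, smul_eq_mul, mul_assoc]
    simp only [WithLp.smul_fst, WithLp.smul_snd]
    rw [e1, e1, hp φ hφ]
    ring

/-- `n` is the outward unit normal of the convex set `D` at the boundary point `x`: it is the one
and only unit vector that is normal to a supporting hyperplane of `D` at `x` and points
away from `D`. -/
def IsOutwardNormal {d : ℕ} (D : Set (E d)) (x n : E d) : Prop :=
  x ∈ frontier D ∧ ‖n‖ = 1 ∧
    ∀ m : E d, ‖m‖ = 1 → ((∀ y ∈ D, ⟪y - x, m⟫ ≤ 0) ↔ m = n)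

/-- The inflow boundary `Γ₋`. -/
def inflow {d : ℕ} (D : Set (E d)) : Set (E d × Sph d) :=
  {z | ∃ n, IsOutwardNormal D z.1 n ∧ ⟪(z.2 : E d), n⟫ < 0}

/-- The outflow boundary `Γ₊`. -/
def outflow {d : ℕ} (D : Set (E d)) : Set (E d × Sph d) :=
  {z | ∃ n, IsOutwardNormal D z.1 n ∧ 0 < ⟪(z.2 : E d), n⟫}

/-- The `C¹` functions on the closure of `D × S` that vanish on `Γ`, as a subspace of `H(D × S)`.
Functions of class `C¹` on the closure are restrictions of `C¹` functions on `ℝᵈ × ℝᵈ`. -/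
def C1Vanishing {d : ℕ} (D : Set (E d)) (Γ : Set (E d × Sph d)) : Submodule ℝ (H D) where
  carrier := {p | ∃ φ : E d × E d → ℝ, ContDiff ℝ 1 φ ∧ (∀ z ∈ Γ, φ (amb z) = 0) ∧
    ⇑(p : WithLp 2 (L2 D × L2 D)).fst =ᵐ[phaseMeasure D] fun z => φ (amb z)}
  zero_mem' := ⟨0, contDiff_const, by simp, by
    simpa using! Lp.coeFn_zero ℝ 2 (phaseMeasure D)⟩
  add_mem' := by
    rintro p q ⟨φ, h1, h2, h3⟩ ⟨ψ, k1, k2, k3⟩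
    refine ⟨φ + ψ, h1.add k1, fun z hz => by simp [h2 z hz, k2 z hz], ?_⟩
    have := Lp.coeFn_add (p : WithLp 2 (L2 D × L2 D)).fst (q : WithLp 2 (L2 D × L2 D)).fst
    simp only [Submodule.coe_add, WithLp.add_fst]
    filter_upwards [this, h3, k3] with z hz hz1 hz2
    rw [hz, Pi.add_apply, hz1, hz2, Pi.add_apply]
  smul_mem' := by
    rintro c p ⟨φ, h1, h2, h3⟩
    refine ⟨c • φ, h1.const_smul c, fun z hz => by simp [h2 z hz], ?_⟩
    have := Lp.coeFn_smul c (p : WithLp 2 (L2 D × L2 D)).fst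
    simp only [Submodule.coe_smul, WithLp.smul_fst]
    filter_upwards [this, h3] with z hz hz1
    rw [hz, Pi.smul_apply, hz1, Pi.smul_apply]

/-- `H_{0,-}(D × S)`: the closure in `H(D × S)` of the `C¹` functions vanishing on `Γ₋`. -/
def HZeroMinus {d : ℕ} (D : Set (E d)) : Submodule ℝ (H D) :=
  (C1Vanishing D (inflow D)).topologicalClosure

/-- `H_{0,+}(D × S)`: the closure in `H(D × S)` of the `C¹` functions vanishing on `Γ₊`. -/
def HZeroPlus {d : ℕ} (D : Set (E d)) : Submodule ℝ (H D) :=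
  (C1Vanishing D (outflow D)).topologicalClosure

/-- The `L₂` function underlying an element of `H(D × S)`. -/
def fn {d : ℕ} {D : Set (E d)} (v : H D) : L2 D := (v : WithLp 2 (L2 D × L2 D)).fst

/-- The transport derivative `s · ∇v` of an element of `H(D × S)`. -/
def tderiv {d : ℕ} {D : Set (E d)} (v : H D) : L2 D := (v : WithLp 2 (L2 D × L2 D)).snd

/-- The scattering operator `(𝒦u)(x, s) = ∫_S K(x, s', s) u(x, s') ds'`. -/
def scatter {d : ℕ} (K : E d × Sph d × Sph d → ℝ) (u : E d × Sph d → ℝ)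
    (z : E d × Sph d) : ℝ :=
  ∫ s', K (z.1, s', z.2) * u (z.1, s') ∂(sphereMeasure d)

/-- The bilinear form of the first formulation, in which the transport derivative acts on the
test function: `b(u, v) = ∫ u (σ v - s · ∇v) - ∫ (𝒦u) v`, with `U = L₂(D × S)` and
`V = H_{0,+}(D × S)`. -/
def formOne {d : ℕ} (D : Set (E d)) (σ : E d × Sph d → ℝ) (K : E d × Sph d × Sph d → ℝ)
    (u : L2 D) (v : HZeroPlus D) : ℝ :=
  ∫ z, u z * (σ z * fn v.1 z - tderiv v.1 z) ∂(phaseMeasure D)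
    - ∫ z, scatter K u z * fn v.1 z ∂(phaseMeasure D)

/-- The bilinear form of the second formulation, in which the transport derivative acts on the
trial function: `b(u, v) = ∫ (s · ∇u + σ u) v - ∫ (𝒦u) v`, with `U = H_{0,-}(D × S)` and
`V = L₂(D × S)`. -/
def formTwo {d : ℕ} (D : Set (E d)) (σ : E d × Sph d → ℝ) (K : E d × Sph d × Sph d → ℝ)
    (u : HZeroMinus D) (v : L2 D) : ℝ :=
  ∫ z, (tderiv u.1 z + σ z * fn u.1 z) * v z ∂(phaseMeasure D)
    - ∫ z, scatter K (fn u.1) z * v z ∂(phaseMeasure D)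

/-- The condition number `‖B‖ ‖B⁻¹‖` of a norm-isomorphism. -/
def conditionNumber {U W : Type*} [NormedAddCommGroup U] [NormedSpace ℝ U]
    [NormedAddCommGroup W] [NormedSpace ℝ W] (B : U ≃L[ℝ] W) : ℝ :=
  ‖(B : U →L[ℝ] W)‖ * ‖(B.symm : W →L[ℝ] U)‖

/-- The variational problem `b(u, v) = ⟨f, v⟩` for all `v ∈ V` is uniquely solvable for every
`f ∈ V'`, with `‖u‖_U ≤ C ‖f‖_{V'}`, and the operator induced by `b` is a norm-isomorphism of `U`
onto `V'` with condition number at most `κ`. -/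
def WellPosed {U V : Type*} [NormedAddCommGroup U] [NormedSpace ℝ U]
    [NormedAddCommGroup V] [NormedSpace ℝ V] (b : U → V → ℝ) (C κ : ℝ) : Prop :=
  (∀ f : StrongDual ℝ V, ∃! u : U, ∀ v, b u v = f v) ∧
  (∀ (f : StrongDual ℝ V) (u : U), (∀ v, b u v = f v) → ‖u‖ ≤ C * ‖f‖) ∧
  ∃ B : U ≃L[ℝ] StrongDual ℝ V, (∀ u v, B u v = b u v) ∧ conditionNumber B ≤ κ

end RadTrans

end

/-! Each form is a pairing with an operator `T + A`. The unbounded part is `T = ε s·∇`, with `ε = 1`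
on `HZeroMinus` and `ε = -1` on `HZeroPlus`. The bounded part `A` is `σ - 𝒦` for (F2) and its
adjoint for (F1), with norm at most `Mσ + MK`.

On a test function `φ` the transport term `⟪s·∇φ, φ⟫` vanishes, so accretivity of the full operator
says that `σ - 𝒦` alone is coercive there. By density it is coercive on all of `L₂`
(`coercive_of_accretive`). Coercivity passes to the adjoint, which is what makes the outflow space
accessible although accretivity is assumed only on the inflow space.

Two facts about transport remain. Green's inequality `integral_transportDeriv_mul_nonneg` makes `T`
accretive on functions vanishing where the characteristics enter. Integration along characteristics
(`exists_transport_solution`) shows that `T + r` reaches every test function, hence has dense range.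

In the graph norm, `T + A` is then bounded, bounded below and onto (`IsAccretive.surjective`), so it
is an isomorphism onto `L₂`. Composing with the Riesz map gives (F2); transposing the outflow
version gives (F1). The constants involve only `α` and the bound on `A`. -/

noncomputable section

namespace RadTrans

/-! ### Coercive bounded perturbations of accretive operators in Hilbert space. -/

section Abstract

/-- A bounded, bounded below and surjective operator into the dual solves its variational
problem. -/
theorem wellPosed_of_bounds {U V : Type*} [NormedAddCommGroup U] [NormedSpace ℝ U]
    [NormedAddCommGroup V] [NormedSpace ℝ V] {b : U → V → ℝ} (B : U →ₗ[ℝ] StrongDual ℝ V)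
    (hB : ∀ u v, B u v = b u v) {M c : ℝ} (hM : 0 ≤ M) (hc : 0 ≤ c)
    (hup : ∀ u, ‖B u‖ ≤ M * ‖u‖) (hlow : ∀ u, ‖u‖ ≤ c * ‖B u‖)
    (hsurj : Function.Surjective B) : WellPosed b c (M * c) := by
  have hinj : Function.Injective B := by
    rw [injective_iff_map_eq_zero]
    intro u hu
    have := hlow u
    rw [hu, norm_zero, mul_zero] at this
    exact norm_le_zero_iff.1 this
  have key : ∀ (f : StrongDual ℝ V) (u : U), (∀ v, b u v = f v) → B u = f := by
    intro f u h
    ext v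
    rw [hB, h]
  refine ⟨fun f => ?_, fun f u h => ?_, ?_⟩
  · obtain ⟨u, hu⟩ := hsurj f
    refine ⟨u, fun v => by rw [← hB, hu], fun w hw => hinj ?_⟩
    rw [hu, key f w hw]
  · rw [← key f u h]
    exact hlow u
  · set e : U ≃ₗ[ℝ] StrongDual ℝ V := LinearEquiv.ofBijective B ⟨hinj, hsurj⟩ with he
    have hinv : ∀ f, ‖e.symm f‖ ≤ c * ‖f‖ := by
      intro f
      have := hlow (e.symm f)
      have h2 : B (e.symm f) = f := e.apply_symm_apply f
      rwa [h2] at this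
    refine ⟨e.toContinuousLinearEquivOfBounds M c hup hinv, fun u v => hB u v, ?_⟩
    refine mul_le_mul (ContinuousLinearMap.opNorm_le_bound _ hM hup)
      (ContinuousLinearMap.opNorm_le_bound _ hc hinv) (norm_nonneg _) hM

variable {X Y : Type*} [NormedAddCommGroup X] [NormedSpace ℝ X]
  [NormedAddCommGroup Y] [InnerProductSpace ℝ Y]

/-- The lower bound makes the image of the complete space `X` closed, and a closed dense set is
everything. -/
theorem surjective_of_norm_le_of_denseRange [CompleteSpace X] {l : X →ₗ[ℝ] Y} {M c : ℝ}
    (hup : ∀ x, ‖l x‖ ≤ M * ‖x‖) (hlow : ∀ x, ‖x‖ ≤ c * ‖l x‖) (hd : DenseRange l) :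
    Function.Surjective l := by
  let L := l.mkContinuous M hup
  have hlow' : ∀ x, ‖x‖ ≤ (c.toNNReal : ℝ) * ‖L x‖ := fun x =>
    (hlow x).trans (mul_le_mul_of_nonneg_right (Real.le_coe_toNNReal c) (norm_nonneg _))
  have hcl : IsClosed (range L) :=
    (L.antilipschitz_of_bound hlow').isClosed_range L.uniformContinuous
  change Function.Surjective L
  rw [← range_eq_univ, ← hcl.closure_eq]
  exact DenseRange.closure_range (f := L) hd

/-- An operator `T` on a space normed by the graph norm of `T`, accretive relative to the
embedding `F`. -/
structure IsAccretive (F T : X →ₗ[ℝ] Y) : Prop where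
  norm_sq : ∀ x, ‖x‖ ^ 2 = ‖F x‖ ^ 2 + ‖T x‖ ^ 2
  inner_nonneg : ∀ x, 0 ≤ ⟪T x, F x⟫

namespace IsAccretive

variable {F T : X →ₗ[ℝ] Y}

theorem norm_le_add (h : IsAccretive F T) (x : X) : ‖x‖ ≤ ‖F x‖ + ‖T x‖ := by
  have := h.norm_sq x
  refine abs_le_of_sq_le_sq' ?_ (by positivity) |>.2
  nlinarith [norm_nonneg (F x), norm_nonneg (T x)]

theorem norm_fst_le (h : IsAccretive F T) (x : X) : ‖F x‖ ≤ ‖x‖ :=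
  abs_le_of_sq_le_sq' (by nlinarith [h.norm_sq x, sq_nonneg ‖T x‖]) (norm_nonneg _) |>.2

theorem norm_snd_le (h : IsAccretive F T) (x : X) : ‖T x‖ ≤ ‖x‖ :=
  abs_le_of_sq_le_sq' (by nlinarith [h.norm_sq x, sq_nonneg ‖F x‖]) (norm_nonneg _) |>.2

variable {A : Y →L[ℝ] Y} {α M : ℝ}

theorem norm_add_le (h : IsAccretive F T) (hA : ∀ y, ‖A y‖ ≤ M * ‖y‖) (hM : 0 ≤ M) (x : X) :
    ‖T x + A (F x)‖ ≤ (1 + M) * ‖x‖ := by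
  calc ‖T x + A (F x)‖ ≤ ‖T x‖ + M * ‖F x‖ := (_root_.norm_add_le _ _).trans (by gcongr; exact hA _)
    _ ≤ ‖x‖ + M * ‖x‖ := by gcongr; exacts [h.norm_snd_le x, h.norm_fst_le x]
    _ = _ := by ring

/-- Pair with `F x`: accretivity discards the contribution of `T`, and Cauchy–Schwarz lets one
factor `‖F x‖` cancel. -/
theorem mul_norm_fst_le (h : IsAccretive F T) (hco : ∀ y, α * ‖y‖ ^ 2 ≤ ⟪A y, y⟫) (x : X) :
    α * ‖F x‖ ≤ ‖T x + A (F x)‖ := by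
  rcases (norm_nonneg (F x)).eq_or_lt with h0 | h0
  · rw [← h0, mul_zero]; exact norm_nonneg _
  · have h1 := real_inner_le_norm (T x + A (F x)) (F x)
    rw [inner_add_left] at h1
    have h2 := h.inner_nonneg x
    have h3 := hco (F x)
    exact le_of_mul_le_mul_right (by nlinarith) h0

/-- Coercivity controls only `F x`. The graph part `T x` is recovered as `(T x + A (F x)) - A (F
x)`, which produces the `1 + M` in the constant. -/
theorem norm_le (h : IsAccretive F T) (hA : ∀ y, ‖A y‖ ≤ M * ‖y‖) (hM : 0 ≤ M) (hα : 0 < α)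
    (hco : ∀ y, α * ‖y‖ ^ 2 ≤ ⟪A y, y⟫) (x : X) :
    ‖x‖ ≤ (1 + (1 + M) / α) * ‖T x + A (F x)‖ := by
  have h1 := h.mul_norm_fst_le hco x
  have h2 : ‖F x‖ ≤ ‖T x + A (F x)‖ / α := by
    rw [le_div_iff₀ hα]; linarith
  have h3 : ‖T x‖ ≤ ‖T x + A (F x)‖ + M * ‖F x‖ := by
    calc ‖T x‖ = ‖(T x + A (F x)) - A (F x)‖ := by rw [add_sub_cancel_right]
      _ ≤ _ := (norm_sub_le _ _).trans (by gcongr; exact hA _)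
  calc ‖x‖ ≤ ‖F x‖ + (‖T x + A (F x)‖ + M * ‖F x‖) := (h.norm_le_add x).trans (by gcongr)
    _ = ‖T x + A (F x)‖ + (1 + M) * ‖F x‖ := by ring
    _ ≤ ‖T x + A (F x)‖ + (1 + M) * (‖T x + A (F x)‖ / α) := by gcongr
    _ = _ := by ring

/-- A coercive perturbation of a maximal accretive operator is onto. -/
theorem surjective [CompleteSpace X] [CompleteSpace Y] (h : IsAccretive F T)
    (hdense : ∀ r : ℝ, 0 < r → DenseRange (fun x => T x + r • F x))
    (hA : ∀ y, ‖A y‖ ≤ M * ‖y‖) (hM : 0 ≤ M) (hα : 0 < α)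
    (hco : ∀ y, α * ‖y‖ ^ 2 ≤ ⟪A y, y⟫) : Function.Surjective (T + A.toLinearMap ∘ₗ F) := by
  refine surjective_of_norm_le_of_denseRange (h.norm_add_le hA hM)
    (h.norm_le hA hM hα hco) ?_
  -- The model perturbation `α • id` is itself coercive with constant `α`, so density of its range
  -- already yields surjectivity.
  have hshift : Function.Surjective (T + α • F) := by
    have h1 : ∀ y : Y, ‖(α • ContinuousLinearMap.id ℝ Y) y‖ ≤ α * ‖y‖ := fun y => by
      simp [norm_smul, abs_of_pos hα]
    have h2 : ∀ y : Y, α * ‖y‖ ^ 2 ≤ ⟪(α • ContinuousLinearMap.id ℝ Y) y, y⟫ := fun y => by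
      simp [inner_smul_left]
    exact surjective_of_norm_le_of_denseRange (h.norm_add_le h1 hα.le)
      (h.norm_le h1 hα.le hα h2) (hdense α hα)
  have hbot : (T + A.toLinearMap ∘ₗ F).rangeᗮ = ⊥ := by
    rw [Submodule.eq_bot_iff]
    intro w hw
    -- With this `u`, the relation `⟪T u + A (F u), w⟫ = 0` becomes `⟪A w, w⟫ - α⟪F u, w⟫ + ⟪F u, T
    -- u⟫ + α‖F u‖² = 0`.
    obtain ⟨u, hu⟩ := hshift (ContinuousLinearMap.adjoint A w)
    have h1 : ⟪T u + A (F u), w⟫ = 0 := hw _ ⟨u, rfl⟩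
    have hu' : T u + α • F u = ContinuousLinearMap.adjoint A w := hu
    have h2 : ⟪A (F u), w⟫ = ⟪F u, T u⟫ + α * ‖F u‖ ^ 2 := by
      rw [← ContinuousLinearMap.adjoint_inner_right, ← hu', inner_add_right, inner_smul_right,
        real_inner_self_eq_norm_sq]
    have h3 : ⟪T u, w⟫ + α * ⟪F u, w⟫ = ⟪A w, w⟫ := by
      rw [← ContinuousLinearMap.adjoint_inner_right A w w, ← hu',
        inner_add_right, inner_smul_right, real_inner_comm, real_inner_comm w (F u)]
    have h4 := hco w
    have h5 := h.inner_nonneg u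
    rw [real_inner_comm] at h5
    have h6 := real_inner_le_norm (F u) w
    rw [inner_add_left] at h1
    have h7 : ‖w‖ ^ 2 ≤ 0 := by
      -- Completing the square in `‖w‖² - ‖F u‖‖w‖ + ‖F u‖² ≤ 0` leaves `3/4 ‖w‖² ≤ 0`.
      have : 0 ≤ α * (‖F u‖ - ‖w‖ / 2) ^ 2 := by positivity
      have : α * ‖w‖ ^ 2 ≤ α * (‖w‖ ^ 2 / 4) := by nlinarith
      nlinarith [le_of_mul_le_mul_left this hα]
    exact norm_le_zero_iff.1 (by nlinarith [norm_nonneg w])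
  have := Submodule.topologicalClosure_eq_top_iff.2 hbot
  exact (Submodule.dense_iff_topologicalClosure_eq_top (s := (T + A.toLinearMap ∘ₗ F).range)).2 this

end IsAccretive

/-- The bilinear map `(u, y) ↦ ⟪L u, y⟫` as an operator into the dual. -/
def innerLeft (L : X →ₗ[ℝ] Y) : X →ₗ[ℝ] StrongDual ℝ Y where
  toFun x := innerSL ℝ (L x)
  map_add' x y := by ext; simp
  map_smul' r x := by ext; simp

/-- The bilinear map `(y, x) ↦ ⟪y, L x⟫` as an operator into the dual. -/
def innerRight (L : X →ₗ[ℝ] Y) {M : ℝ} (hup : ∀ x, ‖L x‖ ≤ M * ‖x‖) :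
    Y →ₗ[ℝ] StrongDual ℝ X where
  toFun y := innerSL ℝ y ∘L L.mkContinuous M hup
  map_add' x y := by ext; simp
  map_smul' r x := by ext; simp

theorem wellPosed_innerLeft [CompleteSpace Y] {L : X →ₗ[ℝ] Y} {M c : ℝ} (hM : 0 ≤ M)
    (hc : 0 ≤ c) (hup : ∀ x, ‖L x‖ ≤ M * ‖x‖) (hlow : ∀ x, ‖x‖ ≤ c * ‖L x‖)
    (hsurj : Function.Surjective L) : WellPosed (fun x y => ⟪L x, y⟫) c (M * c) := by
  have hn : ∀ x, ‖innerLeft L x‖ = ‖L x‖ := fun x => innerSL_apply_norm ℝ (L x)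
  refine wellPosed_of_bounds (innerLeft L) (fun _ _ => rfl) hM hc
    (fun x => by rw [hn]; exact hup x) (fun x => by rw [hn]; exact hlow x) fun f => ?_
  obtain ⟨x, hx⟩ := hsurj ((InnerProductSpace.toDual ℝ Y).symm f)
  refine ⟨x, ?_⟩
  ext y
  change ⟪L x, y⟫ = f y
  rw [hx, InnerProductSpace.toDual_symm_apply]

/-- The transpose of an isomorphism is an isomorphism with the same bounds, so formulation (F1)
loses nothing in the constants. -/
theorem wellPosed_innerRight [CompleteSpace X] [CompleteSpace Y] {L : X →ₗ[ℝ] Y} {M c : ℝ}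
    (hM : 0 ≤ M) (hc : 0 ≤ c) (hup : ∀ x, ‖L x‖ ≤ M * ‖x‖) (hlow : ∀ x, ‖x‖ ≤ c * ‖L x‖)
    (hsurj : Function.Surjective L) : WellPosed (fun y x => ⟪y, L x⟫) c (M * c) := by
  have hinj : Function.Injective L := by
    rw [injective_iff_map_eq_zero]
    intro u hu
    have := hlow u
    rw [hu, norm_zero, mul_zero] at this
    exact norm_le_zero_iff.1 this
  refine wellPosed_of_bounds (innerRight L hup) (fun _ _ => rfl) hM hc (fun y => ?_) (fun y => ?_)
    fun f => ?_
  · refine ContinuousLinearMap.opNorm_le_bound _ (by positivity) fun x => ?_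
    calc ‖⟪y, L x⟫‖ ≤ ‖y‖ * ‖L x‖ := norm_inner_le_norm y (L x)
      _ ≤ ‖y‖ * (M * ‖x‖) := by gcongr; exact hup x
      _ = _ := by ring
  -- Writing `y = L x`, the functional is tested at that same `x`, where it takes the value `‖y‖²`.
  · obtain ⟨x, rfl⟩ := hsurj y
    rcases (norm_nonneg (L x)).eq_or_lt with h0 | h0
    · rw [← h0]; positivity
    · have h1 : ‖L x‖ ^ 2 ≤ ‖innerRight L hup (L x)‖ * ‖x‖ := by
        rw [← real_inner_self_eq_norm_sq]
        exact (Real.le_norm_self _).trans ((innerRight L hup (L x)).le_opNorm x)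
      have h2 : ‖innerRight L hup (L x)‖ * ‖x‖ ≤ ‖innerRight L hup (L x)‖ * (c * ‖L x‖) := by
        gcongr; exact hlow x
      exact le_of_mul_le_mul_right (by nlinarith) h0
  · let e : X ≃L[ℝ] Y := (LinearEquiv.ofBijective L ⟨hinj, hsurj⟩).toContinuousLinearEquivOfBounds
      M c hup fun y => by
        have h1 := hlow ((LinearEquiv.ofBijective L ⟨hinj, hsurj⟩).symm y)
        have h2 : L ((LinearEquiv.ofBijective L ⟨hinj, hsurj⟩).symm y) = y :=
          (LinearEquiv.ofBijective L ⟨hinj, hsurj⟩).apply_symm_apply y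
        rwa [h2] at h1
    refine ⟨(InnerProductSpace.toDual ℝ Y).symm (f ∘L (e.symm : Y →L[ℝ] X)), ?_⟩
    ext x
    change ⟪_, L x⟫ = f x
    rw [InnerProductSpace.toDual_symm_apply]
    change f (e.symm (e x)) = f x
    rw [e.symm_apply_apply]

end Abstract

/-! ### Operators recorded as pairs in a product Hilbert space. -/

section Graph

variable {Y : Type*} [NormedAddCommGroup Y] [InnerProductSpace ℝ Y]
  {G : Submodule ℝ (WithLp 2 (Y × Y))}

/-- The first component on a space of pairs. -/
def graphFst (P : Submodule ℝ G) : P →ₗ[ℝ] Y :=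
  WithLp.fstₗ 2 ℝ Y Y ∘ₗ G.subtype ∘ₗ P.subtype

/-- The second component, scaled by `ε`, on a space of pairs. -/
def graphSnd (P : Submodule ℝ G) (ε : ℝ) : P →ₗ[ℝ] Y :=
  ε • (WithLp.sndₗ 2 ℝ Y Y ∘ₗ G.subtype ∘ₗ P.subtype)

theorem graphSnd_apply {P : Submodule ℝ G} (ε : ℝ) (x : P) :
    graphSnd P ε x = ε • (x : WithLp 2 (Y × Y)).snd := rfl

/-- The sign `ε` reverses the direction of transport; `|ε| = 1` keeps the graph norm unchanged. -/
theorem isAccretive_graph {P : Submodule ℝ G} {ε : ℝ} (hε : |ε| = 1)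
    (hacc : ∀ x : P, 0 ≤ ⟪ε • (x : WithLp 2 (Y × Y)).snd, (x : WithLp 2 (Y × Y)).fst⟫) :
    (IsAccretive (X := P) (Y := Y)) (graphFst P) (graphSnd P ε) where
  norm_sq x := by
    rw [graphSnd_apply, norm_smul, Real.norm_eq_abs, hε, one_mul]
    exact WithLp.prod_norm_sq_eq_of_L2 (x : WithLp 2 (Y × Y))
  inner_nonneg := hacc

variable [CompleteSpace Y] {P : Submodule ℝ G} {ε : ℝ} {A : Y →L[ℝ] Y} {α M : ℝ}

theorem completeSpace_graph (hG : IsClosed (G : Set (WithLp 2 (Y × Y))))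
    (hP : IsClosed (P : Set G)) : CompleteSpace P := by
  have : CompleteSpace G := hG.completeSpace_coe
  exact hP.completeSpace_coe

theorem wellPosed_graph_left (hG : IsClosed (G : Set (WithLp 2 (Y × Y))))
    (hP : IsClosed (P : Set G)) (hε : |ε| = 1)
    (hacc : ∀ x : P, 0 ≤ ⟪ε • (x : WithLp 2 (Y × Y)).snd, (x : WithLp 2 (Y × Y)).fst⟫)
    (hdense : ∀ r : ℝ, 0 < r → DenseRange (fun x : P =>
      ε • (x : WithLp 2 (Y × Y)).snd + r • (x : WithLp 2 (Y × Y)).fst))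
    (hA : ∀ y, ‖A y‖ ≤ M * ‖y‖) (hM : 0 ≤ M) (hα : 0 < α)
    (hco : ∀ y, α * ‖y‖ ^ 2 ≤ ⟪A y, y⟫) :
    WellPosed (fun (x : P) (y : Y) =>
      ⟪ε • (x : WithLp 2 (Y × Y)).snd + A (x : WithLp 2 (Y × Y)).fst, y⟫)
      (1 + (1 + M) / α) ((1 + M) * (1 + (1 + M) / α)) := by
  have := completeSpace_graph hG hP
  have h := isAccretive_graph hε hacc
  exact @wellPosed_innerLeft P Y P.normedAddCommGroup P.normedSpace _ _ _ _ _ _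
    (by positivity) (by positivity) (h.norm_add_le hA hM) (h.norm_le hA hM hα hco)
    (h.surjective hdense hA hM hα hco)

theorem wellPosed_graph_right (hG : IsClosed (G : Set (WithLp 2 (Y × Y))))
    (hP : IsClosed (P : Set G)) (hε : |ε| = 1)
    (hacc : ∀ x : P, 0 ≤ ⟪ε • (x : WithLp 2 (Y × Y)).snd, (x : WithLp 2 (Y × Y)).fst⟫)
    (hdense : ∀ r : ℝ, 0 < r → DenseRange (fun x : P =>
      ε • (x : WithLp 2 (Y × Y)).snd + r • (x : WithLp 2 (Y × Y)).fst))
    (hA : ∀ y, ‖A y‖ ≤ M * ‖y‖) (hM : 0 ≤ M) (hα : 0 < α)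
    (hco : ∀ y, α * ‖y‖ ^ 2 ≤ ⟪A y, y⟫) :
    WellPosed (fun (y : Y) (x : P) =>
      ⟪y, ε • (x : WithLp 2 (Y × Y)).snd + A (x : WithLp 2 (Y × Y)).fst⟫)
      (1 + (1 + M) / α) ((1 + M) * (1 + (1 + M) / α)) := by
  have := completeSpace_graph hG hP
  have h := isAccretive_graph hε hacc
  exact @wellPosed_innerRight P Y P.normedAddCommGroup P.normedSpace _ _ _ _ _ _ _
    (by positivity) (by positivity) (h.norm_add_le hA hM) (h.norm_le hA hM hα hco)
    (h.surjective hdense hA hM hα hco)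

end Graph

/-! ### Continuous, `C¹` and test functions inside `L₂` and `H`. -/

section Transport

variable {d : ℕ} {D : Set (E d)}

theorem isFiniteMeasure_phaseMeasure (hb : Bornology.IsBounded D) :
    IsFiniteMeasure (phaseMeasure D) := by
  have : IsFiniteMeasure ((volume : Measure (E d)).restrict D) :=
    isFiniteMeasure_restrict.2 hb.measure_lt_top.ne
  unfold phaseMeasure
  infer_instance

theorem ae_fst_mem (ho : IsOpen D) : ∀ᵐ z ∂(phaseMeasure D), z.1 ∈ D :=
  Measure.quasiMeasurePreserving_fst.ae (ae_restrict_mem ho.measurableSet)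

theorem memLp_of_continuous (ho : IsOpen D) (hb : Bornology.IsBounded D)
    {g : E d × Sph d → ℝ} (hg : Continuous g) : MemLp g 2 (phaseMeasure D) := by
  have := isFiniteMeasure_phaseMeasure hb
  have hc : IsCompact (closure D ×ˢ (univ : Set (Sph d))) :=
    hb.isCompact_closure.prod isCompact_univ
  obtain ⟨C, hC⟩ := hc.exists_bound_of_continuousOn hg.continuousOn
  refine MemLp.of_bound hg.aestronglyMeasurable C ?_
  filter_upwards [ae_fst_mem ho] with z hz
  exact hC z ⟨subset_closure hz, mem_univ _⟩

theorem integrable_of_continuous (ho : IsOpen D) (hb : Bornology.IsBounded D)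
    {g : E d × Sph d → ℝ} (hg : Continuous g) : Integrable g (phaseMeasure D) := by
  have := isFiniteMeasure_phaseMeasure hb
  exact (memLp_of_continuous ho hb hg).integrable (by norm_num)

theorem continuous_transportDeriv {φ : E d × E d → ℝ} (h : ContDiff ℝ 1 φ) :
    Continuous (transportDeriv φ) := by
  unfold transportDeriv
  exact ((h.continuous_fderiv (by simp)).comp continuous_amb).clm_apply (by fun_prop)

theorem transportDeriv_mul {φ ψ : E d × E d → ℝ} (hφ : ContDiff ℝ 1 φ) (hψ : ContDiff ℝ 1 ψ)
    (z : E d × Sph d) : transportDeriv (φ * ψ) z =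
      φ (amb z) * transportDeriv ψ z + transportDeriv φ z * ψ (amb z) := by
  unfold transportDeriv
  rw [fderiv_mul (hφ.differentiable (by simp) _) (hψ.differentiable (by simp) _)]
  simp
  ring

theorem integral_phaseMeasure (ho : IsOpen D) (hb : Bornology.IsBounded D)
    {g : E d × Sph d → ℝ} (hg : Continuous g) :
    ∫ z, g z ∂(phaseMeasure D) = ∫ s, (∫ x in D, g (x, s)) ∂(sphereMeasure d) :=
  integral_prod_symm g (integrable_of_continuous ho hb hg)

/-- For fixed `s` the slice has compact support in `D`, so the integral extends to all of `ℝᵈ`,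
where integration by parts against the constant `1` gives zero. -/
theorem integral_transportDeriv_eq_zero (ho : IsOpen D) (hb : Bornology.IsBounded D)
    {χ : E d × E d → ℝ} (h : ContDiff ℝ 1 χ) (hc : HasCompactSupport χ)
    (hs : tsupport χ ⊆ D ×ˢ univ) : ∫ z, transportDeriv χ z ∂(phaseMeasure D) = 0 := by
  rw [integral_phaseMeasure ho hb (continuous_transportDeriv h)]
  refine integral_eq_zero_of_ae (Filter.Eventually.of_forall fun s => ?_)
  have hemb : Topology.IsClosedEmbedding (fun x : E d => (x, (s : E d))) :=
    Topology.IsClosedEmbedding.of_continuous_injective_isClosedMap (by fun_prop)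
      (fun a b hab => (Prod.mk.inj hab).1) (fun K hK => by
        have : (fun x : E d => (x, (s : E d))) '' K = K ×ˢ {(s : E d)} := by
          ext ⟨a, b⟩; simp [eq_comm]
        rw [this]
        exact hK.prod isClosed_singleton)
  set g : E d → ℝ := fun x => χ (x, (s : E d)) with hg
  have hg1 : ContDiff ℝ 1 g := h.comp (by fun_prop)
  have hgc : HasCompactSupport g := hc.comp_isClosedEmbedding hemb
  have hder : ∀ x, transportDeriv χ (x, s) = fderiv ℝ g x (s : E d) := by
    intro x
    have e : HasFDerivAt (fun x : E d => (x, (s : E d)))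
      ((ContinuousLinearMap.id ℝ (E d)).prod 0) x :=
      (hasFDerivAt_id x).prodMk (hasFDerivAt_const _ _)
    have := ((h.differentiable (by simp) (x, (s : E d))).hasFDerivAt.comp x e).fderiv
    rw [hg]
    erw [this]
    rfl
  have hout : ∀ x, x ∉ D → fderiv ℝ g x (s : E d) = 0 := by
    intro x hx
    rw [← hder]
    have : (x, (s : E d)) ∉ tsupport χ := fun hh => hx (hs hh).1
    have h0 : fderiv ℝ χ (x, (s : E d)) = 0 := by
      by_contra hne
      exact this (support_fderiv_subset ℝ hne)
    simp [transportDeriv, amb, h0]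
  have hcont : Continuous fun x => fderiv ℝ g x (s : E d) :=
    (hg1.continuous_fderiv (by simp)).clm_apply continuous_const
  have hint : Integrable (fun x => fderiv ℝ g x (s : E d)) :=
    hcont.integrable_of_hasCompactSupport (hgc.fderiv_apply ℝ (s : E d))
  change ∫ x in D, transportDeriv χ (x, s) = 0
  simp_rw [hder]
  rw [setIntegral_eq_integral_of_forall_compl_eq_zero hout]
  have := integral_mul_fderiv_eq_neg_fderiv_mul_of_integrable (μ := (volume : Measure (E d)))
    (f := fun _ => (1 : ℝ)) (g := g) (v := (s : E d)) (by simp) (by simpa using hint)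
    (by simpa using hg1.continuous.integrable_of_hasCompactSupport hgc) (fun _ _ => by fun_prop)
    (fun x _ => hg1.differentiable (by simp) x)
  simpa using this

/-- The class in `L₂(D × S)` of a continuous function. -/
def contL2 (ho : IsOpen D) (hb : Bornology.IsBounded D) {g : E d × Sph d → ℝ}
    (hg : Continuous g) : L2 D := (memLp_of_continuous ho hb hg).toLp g

theorem coeFn_contL2 (ho : IsOpen D) (hb : Bornology.IsBounded D) {g : E d × Sph d → ℝ}
    (hg : Continuous g) : contL2 ho hb hg =ᵐ[phaseMeasure D] g := MemLp.coeFn_toLp _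

/-- By the product rule the claim is that the transport derivative of `φ * ψ` integrates to zero;
the support of `ψ` over `D` removes any boundary term. -/
theorem isWeakTransportDeriv_contL2 (ho : IsOpen D) (hb : Bornology.IsBounded D)
    {φ : E d × E d → ℝ} (h : ContDiff ℝ 1 φ) :
    IsWeakTransportDeriv D (contL2 ho hb (h.continuous.comp continuous_amb))
      (contL2 ho hb (continuous_transportDeriv h)) := by
  intro ψ hψ
  have hψ1 : ContDiff ℝ 1 ψ := hψ.1.of_le (by simp)
  have e1 : ∫ z, contL2 ho hb (h.continuous.comp continuous_amb) z * transportDeriv ψ z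
      ∂(phaseMeasure D) = ∫ z, φ (amb z) * transportDeriv ψ z ∂(phaseMeasure D) := by
    refine integral_congr_ae ?_
    filter_upwards [coeFn_contL2 ho hb (h.continuous.comp continuous_amb)] with z hz
    rw [hz]; rfl
  have e2 : ∫ z, contL2 ho hb (continuous_transportDeriv h) z * ψ (amb z)
      ∂(phaseMeasure D) = ∫ z, transportDeriv φ z * ψ (amb z) ∂(phaseMeasure D) := by
    refine integral_congr_ae ?_
    filter_upwards [coeFn_contL2 ho hb (continuous_transportDeriv h)] with z hz
    rw [hz]
  rw [e1, e2, eq_neg_iff_add_eq_zero, ← integral_add]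
  · simp_rw [← transportDeriv_mul h hψ1]
    exact integral_transportDeriv_eq_zero ho hb (h.mul hψ1) hψ.2.1.mul_left
      ((tsupport_mul_subset_right).trans hψ.2.2)
  · exact integrable_of_continuous ho hb
      ((h.continuous.comp continuous_amb).mul (continuous_transportDeriv hψ1))
  · exact integrable_of_continuous ho hb
      ((continuous_transportDeriv h).mul (hψ1.continuous.comp continuous_amb))

/-- A function of class `C¹` on the closure, as an element of `H(D × S)`. -/
def ofC1 (ho : IsOpen D) (hb : Bornology.IsBounded D) {φ : E d × E d → ℝ}
    (h : ContDiff ℝ 1 φ) : H D :=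
  ⟨WithLp.toLp 2 (contL2 ho hb (h.continuous.comp continuous_amb),
    contL2 ho hb (continuous_transportDeriv h)), isWeakTransportDeriv_contL2 ho hb h⟩

theorem fn_ofC1 (ho : IsOpen D) (hb : Bornology.IsBounded D) {φ : E d × E d → ℝ}
    (h : ContDiff ℝ 1 φ) : fn (ofC1 ho hb h) =ᵐ[phaseMeasure D] fun z => φ (amb z) :=
  coeFn_contL2 ho hb (h.continuous.comp continuous_amb)

theorem tderiv_ofC1 (ho : IsOpen D) (hb : Bornology.IsBounded D) {φ : E d × E d → ℝ}
    (h : ContDiff ℝ 1 φ) : tderiv (ofC1 ho hb h) =ᵐ[phaseMeasure D] transportDeriv φ :=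
  coeFn_contL2 ho hb (continuous_transportDeriv h)

/-- The class in `L₂(D × S)` of a test function. -/
def testL2 {φ : E d × E d → ℝ} (h : IsTest D φ) : L2 D := h.memLp.toLp _

theorem inner_eq_integral (f g : L2 D) : ⟪f, g⟫ = ∫ z, f z * g z ∂(phaseMeasure D) := by
  rw [L2.inner_def]
  refine integral_congr_ae (Filter.Eventually.of_forall fun z => ?_)
  simp [mul_comm]

theorem inner_toLp (f : L2 D) {g : E d × Sph d → ℝ} (hg : MemLp g 2 (phaseMeasure D)) :
    ⟪f, hg.toLp g⟫ = ∫ z, f z * g z ∂(phaseMeasure D) := by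
  rw [inner_eq_integral]
  refine integral_congr_ae ?_
  filter_upwards [hg.coeFn_toLp] with z hz
  rw [hz]

theorem isWeakTransportDeriv_iff {v g : L2 D} : IsWeakTransportDeriv D v g ↔
    ∀ (φ : E d × E d → ℝ) (h : IsTest D φ),
      ⟪v, h.memLp_deriv.toLp _⟫ = -⟪g, testL2 h⟫ := by
  refine forall₂_congr fun φ h => ?_
  rw [testL2, inner_toLp, inner_toLp]

theorem eq_zero_of_inner_testL2 (ho : IsOpen D) (hb : Bornology.IsBounded D) {g : L2 D}
    (h : ∀ (φ : E d × E d → ℝ) (hφ : IsTest D φ), ⟪g, testL2 hφ⟫ = 0) : g = 0 := by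
  have := isFiniteMeasure_phaseMeasure hb
  have hemb : MeasurableEmbedding (amb : E d × Sph d → E d × E d) :=
    isClosedEmbedding_amb.measurableEmbedding
  -- Test functions live on `ℝᵈ × ℝᵈ`, so `g` and the measure are transported there along `amb`, and
  -- the fundamental lemma of the calculus of variations applies on the open set `D × ℝᵈ`.
  set G : E d × E d → ℝ := Function.extend amb g 0 with hG
  have hGa : ∀ z, G (amb z) = g z := fun z => hemb.injective.extend_apply _ _ _
  have hint : Integrable G ((phaseMeasure D).map amb) := by
    rw [hemb.integrable_map_iff]
    have : G ∘ amb = g := funext hGa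
    rw [this]
    exact (Lp.memLp g).integrable (by norm_num)
  have hae := (ho.prod isOpen_univ).ae_eq_zero_of_integral_contDiff_smul_eq_zero
    (hint.locallyIntegrable.locallyIntegrableOn (D ×ˢ (univ : Set (E d)))) (fun ψ h1 h2 h3 => by
      rw [hemb.integral_map]
      have hψ : IsTest D ψ := ⟨h1, h2, h3⟩
      have h0 : ⟪g, hψ.memLp.toLp _⟫ = 0 := h ψ hψ
      rw [inner_toLp] at h0
      rw [← h0]
      refine integral_congr_ae (Filter.Eventually.of_forall fun z => ?_)
      simp only [hGa, smul_eq_mul, mul_comm])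
  rw [hemb.ae_map_iff] at hae
  refine (Lp.eq_zero_iff_ae_eq_zero).2 ?_
  filter_upwards [hae, ae_fst_mem ho] with z hz hz1
  rw [← hGa, hz ⟨hz1, mem_univ _⟩, Pi.zero_apply]

theorem dense_testL2 (ho : IsOpen D) (hb : Bornology.IsBounded D) :
    Dense {f : L2 D | ∃ (φ : E d × E d → ℝ) (h : IsTest D φ), f = testL2 h} := by
  let P : Submodule ℝ (L2 D) :=
    { carrier := {f : L2 D | ∃ (φ : E d × E d → ℝ) (h : IsTest D φ), f = testL2 h}
      zero_mem' := ⟨0, ⟨contDiff_const, HasCompactSupport.zero, by simp [tsupport]⟩, rfl⟩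
      add_mem' := by
        rintro _ _ ⟨φ, h, rfl⟩ ⟨ψ, k, rfl⟩
        exact ⟨φ + ψ, ⟨h.1.add k.1, h.2.1.add k.2.1,
          (tsupport_add φ ψ).trans (union_subset h.2.2 k.2.2)⟩, rfl⟩
      smul_mem' := by
        rintro c _ ⟨φ, h, rfl⟩
        exact ⟨c • φ, ⟨h.1.const_smul c, h.2.1.smul_left (f := fun _ => c),
          (tsupport_smul_subset_right (fun _ => c) φ).trans h.2.2⟩, rfl⟩ }
  change Dense (P : Set (L2 D))
  rw [Submodule.dense_iff_topologicalClosure_eq_top, Submodule.topologicalClosure_eq_top_iff,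
    Submodule.eq_bot_iff]
  intro g hg
  refine eq_zero_of_inner_testL2 ho hb fun φ hφ => ?_
  rw [real_inner_comm]
  exact hg _ ⟨φ, hφ, rfl⟩

/-- Elements of `H` are pairs, while `C1Vanishing` prescribes only the first entry; this identifies
the second as the classical derivative. -/
theorem tderiv_unique (ho : IsOpen D) (hb : Bornology.IsBounded D) {p q : H D}
    (h : fn p = fn q) : tderiv p = tderiv q := by
  rw [← sub_eq_zero]
  refine eq_zero_of_inner_testL2 ho hb fun φ hφ => ?_
  have h1 := isWeakTransportDeriv_iff.1 p.2 φ hφ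
  have h2 := isWeakTransportDeriv_iff.1 q.2 φ hφ
  change ⟪fn p, _⟫ = -⟪tderiv p, _⟫ at h1
  change ⟪fn q, _⟫ = -⟪tderiv q, _⟫ at h2
  rw [inner_sub_left]
  rw [h] at h1
  linarith

theorem tderiv_ae_eq (ho : IsOpen D) (hb : Bornology.IsBounded D) {p : H D}
    {φ : E d × E d → ℝ} (h : ContDiff ℝ 1 φ)
    (hp : fn p =ᵐ[phaseMeasure D] fun z => φ (amb z)) :
    tderiv p =ᵐ[phaseMeasure D] transportDeriv φ := by
  rw [tderiv_unique ho hb (Lp.ext (hp.trans (fn_ofC1 ho hb h).symm))]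
  exact tderiv_ofC1 ho hb h

theorem isClosed_H : IsClosed (H D : Set (WithLp 2 (L2 D × L2 D))) := by
  have : (H D : Set (WithLp 2 (L2 D × L2 D))) =
      ⋂ (φ : E d × E d → ℝ) (h : IsTest D φ),
        {p | ⟪p.fst, h.memLp_deriv.toLp _⟫ = -⟪p.snd, testL2 h⟫} := by
    ext p
    simp only [mem_iInter, mem_ofPred_eq]
    exact isWeakTransportDeriv_iff
  rw [this]
  refine isClosed_iInter fun φ => isClosed_iInter fun h => isClosed_eq ?_ ?_
  · exact (WithLp.fstL 2 ℝ (L2 D) (L2 D)).continuous.inner continuous_const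
  · exact ((WithLp.sndL 2 ℝ (L2 D) (L2 D)).continuous.inner continuous_const).neg

/-! ### Supporting normals of a convex domain. -/

section Geometry

theorem exists_unit_supporting (ho : IsOpen D) (hD : Convex ℝ D) (hne : D.Nonempty) {x : E d}
    (hx : x ∉ D) : ∃ m : E d, ‖m‖ = 1 ∧ ∀ y ∈ D, ⟪y - x, m⟫ ≤ 0 := by
  obtain ⟨f, hf⟩ := geometric_hahn_banach_open_point hD ho hx
  set w := (InnerProductSpace.toDual ℝ (E d)).symm f with hw
  have hfw : ∀ y, f y = ⟪w, y⟫ := fun y => (InnerProductSpace.toDual_symm_apply).symm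
  have hw0 : w ≠ 0 := by
    intro h0
    obtain ⟨y, hy⟩ := hne
    have := hf y hy
    simp [hfw, h0] at this
  refine ⟨‖w‖⁻¹ • w, norm_smul_inv_norm hw0, fun y hy => ?_⟩
  rw [inner_smul_right, real_inner_comm, inner_sub_right, ← hfw, ← hfw]
  exact mul_nonpos_of_nonneg_of_nonpos (by positivity) (by linarith [hf y hy])

/-- A unit normal supporting `D` at `x` also supports the ball touching there, and the ball admits
only the radial one. Existence comes from Hahn–Banach, and uniqueness identifies that normal with
the radial one. -/
theorem isOutwardNormal_of_inscribed_ball (ho : IsOpen D) (hD : Convex ℝ D) {x y : E d} {r : ℝ}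
    (hr : 0 < r) (hball : Metric.ball y r ⊆ D) (hx : x ∈ frontier D) (hxy : ‖x - y‖ = r) :
    IsOutwardNormal D x (r⁻¹ • (x - y)) := by
  have huniq : ∀ m : E d, ‖m‖ = 1 → (∀ z ∈ D, ⟪z - x, m⟫ ≤ 0) → m = r⁻¹ • (x - y) := by
    intro m hm hsup
    have h1 : ∀ t ∈ Ioo (0 : ℝ) r, t ≤ ⟪x - y, m⟫ := by
      intro t ht
      have := hsup (y + t • m) (hball (by simp [norm_smul, hm, abs_of_pos ht.1, ht.2]))
      rw [show y + t • m - x = t • m - (x - y) by abel, inner_sub_left, inner_smul_left,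
        real_inner_self_eq_norm_sq, hm] at this
      simp at this
      linarith
    have h2 : r ≤ ⟪x - y, m⟫ := by
      refine le_of_forall_lt fun c hc => ?_
      have h3 : max c 0 < r := max_lt hc hr
      have := h1 ((max c 0 + r) / 2) ⟨by linarith [le_max_right c 0], by linarith⟩
      linarith [le_max_left c 0]
    -- Equality case of Cauchy–Schwarz: `r ≤ ⟪x - y, m⟫` while `‖x - y‖ = r` and `‖m‖ = 1`.
    have h4 : ‖(x - y) - r • m‖ ^ 2 ≤ 0 := by
      rw [norm_sub_sq_real, inner_smul_right, norm_smul, hm, hxy, Real.norm_eq_abs, abs_of_pos hr]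
      nlinarith
    have h5 : (x - y) - r • m = 0 := by
      rw [← norm_le_zero_iff]
      nlinarith [norm_nonneg ((x - y) - r • m)]
    rw [sub_eq_zero.1 h5, smul_smul, inv_mul_cancel₀ hr.ne', one_smul]
  refine ⟨hx, by rw [norm_smul, hxy, norm_inv, Real.norm_eq_abs, abs_of_pos hr,
    inv_mul_cancel₀ hr.ne'], fun m hm => ⟨huniq m hm, ?_⟩⟩
  rintro rfl
  have hxD : x ∉ D := by
    rw [ho.frontier_eq] at hx
    exact hx.2
  obtain ⟨m', hm', hsup⟩ := exists_unit_supporting ho hD ⟨y, hball (Metric.mem_ball_self hr)⟩ hxD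
  rwa [← huniq m' hm' hsup]

/-- The boundary points with a unique outward normal are dense in the boundary. -/
theorem exists_isOutwardNormal_near (ho : IsOpen D) (hD : Convex ℝ D) {x : E d}
    (hx : x ∈ frontier D) {δ : ℝ} (hδ : 0 < δ) :
    ∃ x' n, dist x' x < δ ∧ IsOutwardNormal D x' n := by
  have hx' := hx
  rw [ho.frontier_eq] at hx'
  -- The point of the complement nearest to `y` touches a ball inscribed around `y` and is no
  -- farther from `y` than `x` is; hence `δ / 2`.
  obtain ⟨y, hy, hyx⟩ := Metric.mem_closure_iff.1 hx'.1 (δ / 2) (by positivity)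
  have hcl : IsClosed Dᶜ := ho.isClosed_compl
  have hnec : (Dᶜ).Nonempty := ⟨x, hx'.2⟩
  obtain ⟨x', hx'c, hdist⟩ := hcl.exists_infDist_eq_dist hnec y
  have hr : 0 < Metric.infDist y Dᶜ := (hcl.notMem_iff_infDist_pos hnec).1 (by simpa using hy)
  have hball : Metric.ball y (Metric.infDist y Dᶜ) ⊆ D := Metric.ball_infDist_compl_subset
  have hx'f : x' ∈ frontier D := by
    rw [ho.frontier_eq]
    refine ⟨closure_mono hball ?_, hx'c⟩
    rw [closure_ball _ hr.ne', hdist, Metric.mem_closedBall, dist_comm]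
  refine ⟨x', _, ?_, isOutwardNormal_of_inscribed_ball ho hD hr hball hx'f ?_⟩
  · have h1 : dist y x' ≤ dist y x := by
      rw [← hdist]; exact Metric.infDist_le_dist_of_mem hx'.2
    rw [dist_comm] at hyx
    calc dist x' x ≤ dist x' y + dist y x := dist_triangle _ _ _
      _ < δ := by rw [dist_comm x' y]; linarith
  · rw [← dist_eq_norm, dist_comm, hdist]

/-- The inequality is strict because `D` is open: `y` can be pushed a little along `n` without
leaving `D`. -/
theorem IsOutwardNormal.inner_neg (ho : IsOpen D) {x n y : E d} (h : IsOutwardNormal D x n)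
    (hy : y ∈ D) : ⟪y - x, n⟫ < 0 := by
  obtain ⟨η, hη, hb⟩ := Metric.isOpen_iff.1 ho y hy
  have h1 := (h.2.2 n h.2.1).2 rfl (y + (η / 2) • n) (hb (by
    simp [norm_smul, h.2.1, abs_of_pos hη, hη]))
  rw [show y + (η / 2) • n - x = (y - x) + (η / 2) • n by abel, inner_add_left, inner_smul_left,
    real_inner_self_eq_norm_sq, h.2.1] at h1
  simp at h1
  linarith

/-- The part of the boundary where the line in direction `ε s` enters the domain. -/
def entrySet (D : Set (E d)) (ε : ℝ) : Set (E d × Sph d) :=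
  {z | ∃ n, IsOutwardNormal D z.1 n ∧ ε * ⟪(z.2 : E d), n⟫ < 0}

theorem inflow_eq_entrySet : inflow D = entrySet D 1 := by simp [inflow, entrySet]

theorem outflow_eq_entrySet : outflow D = entrySet D (-1) := by simp [outflow, entrySet]

/-- There may be no unique normal at `x`. Nearby boundary points that have one still satisfy the
open condition of entering `D` after time `t`, which forces `ε⟪s, n⟫ < 0`; continuity of `φ` passes
the zero to `x`. -/
theorem eq_zero_of_enters (ho : IsOpen D) (hD : Convex ℝ D) {ε : ℝ} {φ : E d × E d → ℝ}
    (hφ : Continuous φ) (hz : ∀ z ∈ entrySet D ε, φ (amb z) = 0) {x : E d} {s : Sph d} {t : ℝ}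
    (hx : x ∈ frontier D) (ht : 0 < t) (hxt : x + t • (ε • (s : E d)) ∈ D) :
    φ (x, (s : E d)) = 0 := by
  have hcl : IsClosed {y : E d | φ (y, (s : E d)) = 0} :=
    isClosed_eq (by fun_prop) continuous_const
  have hop : IsOpen {y : E d | y + t • (ε • (s : E d)) ∈ D} := ho.preimage (by fun_prop)
  obtain ⟨η, hη, hb⟩ := Metric.isOpen_iff.1 hop x hxt
  refine hcl.closure_subset (Metric.mem_closure_iff.2 fun δ hδ => ?_)
  obtain ⟨x', n, hd, hn⟩ := exists_isOutwardNormal_near ho hD hx (lt_min hδ hη)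
  refine ⟨x', hz (x', s) ⟨n, hn, ?_⟩, by rw [dist_comm]; exact hd.trans_le (min_le_left _ _)⟩
  have h1 : x' + t • (ε • (s : E d)) ∈ D := hb (hd.trans_le (min_le_right _ _))
  have h2 := hn.inner_neg ho h1
  rw [add_sub_cancel_left, inner_smul_left, inner_smul_left] at h2
  exact (pos_iff_neg_of_mul_neg h2).1 (by simpa using ht)

end Geometry

/-! ### Green's inequality by translation, without traces. -/

theorem inter_frontier_nonempty_of_isPreconnected {X : Type*} [TopologicalSpace X] {s t : Set X}
    (hs : IsPreconnected s) (ht : IsOpen t) (h1 : (s ∩ t).Nonempty) (h2 : ¬s ⊆ t) :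
    (s ∩ frontier t).Nonempty := by
  by_contra hemp
  rw [not_nonempty_iff_eq_empty, ht.frontier_eq] at hemp
  have hcov : s ⊆ t ∪ (closure t)ᶜ := fun x hx => by
    by_contra hx'
    rw [mem_union, not_or, notMem_compl_iff] at hx'
    exact (hemp ▸ ⟨hx, hx'.2, hx'.1⟩ : x ∈ (∅ : Set X))
  obtain ⟨x, hx, hxt⟩ := not_subset.1 h2
  obtain ⟨y, -, hy1, hy2⟩ := hs t (closure t)ᶜ ht isClosed_closure.isOpen_compl hcov h1
    ⟨x, hx, (hcov hx).resolve_left hxt⟩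
  exact hy2 (subset_closure hy1)

/-- Where `x - h • v` stays in `D`, the integrand is dominated by a translate of `g²` restricted to
`D`, whose integral over the whole space is `∫_D g²`; elsewhere `C` bounds it. -/
theorem setIntegral_translate_sq_le {g : E d → ℝ} {v : E d} {h C : ℝ} (ho : IsOpen D)
    (hb : Bornology.IsBounded D) (hg : Continuous g)
    (hbd : ∀ x ∈ D, x - h • v ∉ D → g (x - h • v) ^ 2 ≤ C) (hC : 0 ≤ C) :
    ∫ x in D, g (x - h • v) ^ 2 ≤ (∫ x in D, g x ^ 2) + C * volume.real D := by
  classical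
  have hm := ho.measurableSet
  have hfin : ∀ k : E d → ℝ, Continuous k → IntegrableOn k D := fun k hk =>
    (hk.continuousOn.integrableOn_compact hb.isCompact_closure).mono_set subset_closure
  rw [← integral_indicator hm, ← integral_indicator hm,
    ← integral_sub_right_eq_self (D.indicator fun x => g x ^ 2) (h • v), mul_comm,
    ← smul_eq_mul, ← setIntegral_const, ← integral_indicator hm, ← integral_add]
  · refine integral_mono ?_ ?_ fun x => ?_
    · exact (hfin _ (by fun_prop)).integrable_indicator hm
    · exact (((hfin _ (by fun_prop)).integrable_indicator hm).comp_sub_right (h • v)).add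
        ((hfin _ (by fun_prop)).integrable_indicator hm)
    · simp only [indicator_apply]
      split_ifs with h1 h2 h2
      · linarith
      · linarith [hbd x h1 h2]
      · positivity
      · simp
  · exact ((hfin _ (by fun_prop)).integrable_indicator hm).comp_sub_right (h • v)
  · exact (hfin _ (by fun_prop)).integrable_indicator hm

/-- Twice the integral is the derivative at `0` of `I t = ∫_D g(x + t v)²`. Translating backwards
brings in only points beyond the entry boundary, where `g` is `O(h)`, so `I (-h) ≤ I 0 + O(h²)`. -/
theorem setIntegral_mul_fderiv_nonneg {g : E d → ℝ} {v : E d} (ho : IsOpen D)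
    (hb : Bornology.IsBounded D) (hg : ContDiff ℝ 1 g)
    (hz : ∀ x ∈ frontier D, ∀ t : ℝ, 0 < t → x + t • v ∈ D → g x = 0) :
    0 ≤ ∫ x in D, g x * fderiv ℝ g x v := by
  have hdc : Continuous fun x => fderiv ℝ g x v :=
    (hg.continuous_fderiv (by simp)).clm_apply continuous_const
  have hgc := hg.continuous
  have hder : ∀ (x : E d) (t : ℝ), HasDerivAt (fun t : ℝ => g (x + t • v))
      (fderiv ℝ g (x + t • v) v) t := by
    intro x t
    have h1 : HasDerivAt (fun t : ℝ => x + t • v) v t := by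
      simpa using ((hasDerivAt_id t).smul_const v).const_add x
    exact ((hg.differentiable (by simp) (x + t • v)).hasFDerivAt).comp_hasDerivAt t h1
  have hK : IsCompact (closure D ×ˢ Icc (-1 : ℝ) 1) :=
    hb.isCompact_closure.prod isCompact_Icc
  obtain ⟨C₁, hC₁⟩ := hK.exists_bound_of_continuousOn
    (f := fun p : E d × ℝ => fderiv ℝ g (p.1 + p.2 • v) v)
    (hdc.comp (by fun_prop : Continuous fun p : E d × ℝ => p.1 + p.2 • v)).continuousOn
  obtain ⟨C₂, hC₂⟩ := hK.exists_bound_of_continuousOn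
    (f := fun p : E d × ℝ => 2 * g (p.1 + p.2 • v) * fderiv ℝ g (p.1 + p.2 • v) v)
    ((by fun_prop : Continuous fun p : E d × ℝ => 2 * g (p.1 + p.2 • v)).mul
      (hdc.comp (by fun_prop : Continuous fun p : E d × ℝ => p.1 + p.2 • v))).continuousOn
  have : IsFiniteMeasure ((volume : Measure (E d)).restrict D) :=
    isFiniteMeasure_restrict.2 hb.measure_lt_top.ne
  set I : ℝ → ℝ := fun t => ∫ x in D, g (x + t • v) ^ 2 with hI
  have hI' : HasDerivAt I (∫ x in D, 2 * g (x + (0 : ℝ) • v) *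
      fderiv ℝ g (x + (0 : ℝ) • v) v) 0 := by
    refine (hasDerivAt_integral_of_dominated_loc_of_deriv_le (bound := fun _ => C₂)
      (F := fun t x => g (x + t • v) ^ 2)
      (F' := fun t x => 2 * g (x + t • v) * fderiv ℝ g (x + t • v) v)
      (Metric.ball_mem_nhds (0 : ℝ) one_pos) ?_ ?_ ?_ ?_ (integrable_const _) ?_).2
    · exact Filter.Eventually.of_forall fun t =>
        (by fun_prop : Continuous fun x => g (x + t • v) ^ 2).aestronglyMeasurable
    · exact ((by fun_prop : Continuous fun x => g (x + (0 : ℝ) • v) ^ 2).continuousOn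
        |>.integrableOn_compact hb.isCompact_closure).mono_set subset_closure
    · exact ((by fun_prop : Continuous fun x => 2 * g (x + (0 : ℝ) • v)).mul
        (hdc.comp (by fun_prop : Continuous fun x => x + (0 : ℝ) • v))).aestronglyMeasurable
    · filter_upwards [ae_restrict_mem ho.measurableSet] with x hx t ht
      rw [mem_ball_zero_iff, Real.norm_eq_abs, abs_lt] at ht
      exact hC₂ (x, t) ⟨subset_closure hx, ht.1.le, ht.2.le⟩
    · refine Filter.Eventually.of_forall fun x t _ => ?_
      simpa using (hder x t).fun_pow 2
  have hle : ∀ h ∈ Ioo (0 : ℝ) 1, I (-h) ≤ I 0 + (C₁ * h) ^ 2 * volume.real D := by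
    intro h hh
    have key := setIntegral_translate_sq_le (v := v) (h := h) (C := (C₁ * h) ^ 2) ho hb hgc
      (fun x hx hxh => ?_) (sq_nonneg _)
    · simpa [hI, sub_eq_add_neg] using key
    -- The backward segment leaves `D`, so it meets the frontier at some `x + τ v`. From there the
    -- line returns to `x`, hence `g` vanishes at that point, and the mean value inequality bounds
    -- `g` at the endpoint by `C₁ h`.
    · have hpc : IsPreconnected ((fun τ : ℝ => x + τ • v) '' Icc (-h) 0) :=
        isPreconnected_Icc.image _ (by fun_prop)
      obtain ⟨-, ⟨τ, hτ, rfl⟩, hfr⟩ :=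
        inter_frontier_nonempty_of_isPreconnected hpc ho ⟨x, ⟨0, ⟨by linarith [hh.1], le_rfl⟩, by simp⟩, hx⟩
        fun hsub => hxh (hsub ⟨-h, ⟨le_rfl, by linarith [hh.1]⟩, by simp [sub_eq_add_neg]⟩)
      have hτ0 : τ < 0 := by
        refine lt_of_le_of_ne hτ.2 ?_
        rintro rfl
        rw [ho.frontier_eq] at hfr
        exact hfr.2 (by simpa using hx)
      have hg0 : g (x + τ • v) = 0 :=
        hz _ hfr (-τ) (by linarith) (by simpa [add_assoc, ← add_smul] using hx)
      have hmv := (convex_Icc (-1 : ℝ) 1).norm_image_sub_le_of_norm_hasDerivWithin_le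
        (f := fun t : ℝ => g (x + t • v)) (C := C₁) (x := τ) (y := -h)
        (fun t _ => (hder x t).hasDerivWithinAt)
        (fun t ht => hC₁ (x, t) ⟨subset_closure hx, ht⟩)
        ⟨by linarith [hh.2, hτ.1], by linarith⟩ ⟨by linarith [hh.2], by linarith [hh.1]⟩
      rw [hg0, sub_zero, Real.norm_eq_abs, Real.norm_eq_abs] at hmv
      have hC₁0 : 0 ≤ C₁ := (norm_nonneg _).trans
        (hC₁ (x, 0) ⟨subset_closure hx, by norm_num, by norm_num⟩)
      have h3 : |-h - τ| ≤ h := by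
        rw [abs_le]; constructor <;> linarith [hτ.1]
      rw [sub_eq_add_neg, ← neg_smul]
      exact sq_le_sq' (by linarith [abs_le.1 (hmv.trans (mul_le_mul_of_nonneg_left h3 hC₁0))])
        (abs_le.1 (hmv.trans (mul_le_mul_of_nonneg_left h3 hC₁0))).2
  set V := volume.real D
  -- The quadratic error has zero derivative at `0`, so the right difference quotients converge to
  -- `-I'(0)`.
  have hJ : HasDerivAt (fun h : ℝ => I (-h) - (C₁ * h) ^ 2 * V)
      (-(∫ x in D, 2 * g (x + (0 : ℝ) • v) * fderiv ℝ g (x + (0 : ℝ) • v) v)) 0 := by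
    have h1 : HasDerivAt (fun h : ℝ => I (-h)) _ 0 :=
      HasDerivAt.comp (h₂ := I) (h := fun h : ℝ => -h) (0 : ℝ) (by simpa using hI')
        (hasDerivAt_neg _)
    have h2 : HasDerivAt (fun h : ℝ => (C₁ * h) ^ 2 * V) 0 0 := by
      simpa using ((((hasDerivAt_id (0 : ℝ)).const_mul C₁).fun_pow 2).mul_const V)
    simpa using h1.fun_sub h2
  have hlim := hJ.tendsto_slope_zero_right
  have hfin : -(∫ x in D, 2 * g (x + (0 : ℝ) • v) * fderiv ℝ g (x + (0 : ℝ) • v) v) ≤ 0 := by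
    refine le_of_tendsto hlim ?_
    filter_upwards [Ioo_mem_nhdsGT (one_pos : (0 : ℝ) < 1)] with h hh
    have := hle h hh
    simp only [zero_add, neg_zero, mul_zero, smul_eq_mul]
    refine mul_nonpos_of_nonneg_of_nonpos (inv_nonneg.2 hh.1.le) ?_
    norm_num
    linarith
  simp only [zero_smul, add_zero, mul_assoc] at hfin
  rw [integral_const_mul] at hfin
  linarith

/-- Green's inequality for functions vanishing where the lines in direction `ε s` enter. -/
theorem integral_transportDeriv_mul_nonneg (ho : IsOpen D) (hb : Bornology.IsBounded D)
    (hD : Convex ℝ D) {ε : ℝ} {φ : E d × E d → ℝ} (h : ContDiff ℝ 1 φ)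
    (hz : ∀ z ∈ entrySet D ε, φ (amb z) = 0) :
    0 ≤ ∫ z, φ (amb z) * (ε * transportDeriv φ z) ∂(phaseMeasure D) := by
  rw [integral_phaseMeasure ho hb (g := fun z => φ (amb z) * (ε * transportDeriv φ z))
    ((h.continuous.comp continuous_amb).mul
      (continuous_const.mul (continuous_transportDeriv h)))]
  refine integral_nonneg fun s => ?_
  have hg1 : ContDiff ℝ 1 fun x : E d => φ (x, (s : E d)) := h.comp (by fun_prop)
  have := setIntegral_mul_fderiv_nonneg (v := ε • (s : E d)) ho hb hg1
    (fun x hx t ht hxt => eq_zero_of_enters ho hD h.continuous hz hx ht hxt)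
  refine this.trans_eq (integral_congr_ae (Filter.Eventually.of_forall fun x => ?_))
  simp only [map_smul, smul_eq_mul, amb]
  congr 2
  have e : HasFDerivAt (fun x : E d => (x, (s : E d)))
    ((ContinuousLinearMap.id ℝ (E d)).prod 0) x :=
    (hasFDerivAt_id x).prodMk (hasFDerivAt_const _ _)
  have := ((h.differentiable (by simp) (x, (s : E d))).hasFDerivAt.comp x e).fderiv
  erw [this]
  rfl

/-! ### Solving the damped transport equation along characteristics. -/

/-- The shear `(x, s) ↦ (x - c s, s)`. -/
def shear (d : ℕ) (c : ℝ) : E d × E d →L[ℝ] E d × E d :=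
  ContinuousLinearMap.id ℝ _ - c • (ContinuousLinearMap.inl ℝ (E d) (E d) ∘L
    ContinuousLinearMap.snd ℝ (E d) (E d))

theorem shear_apply (c : ℝ) (z : E d × E d) : shear d c z = (z.1 - c • z.2, z.2) := by
  ext <;> simp [shear]

/-- The integral of `f` along characteristics with damping `r`. -/
def charIntegral (ε r R : ℝ) (f : E d × E d → ℝ) (z : E d × E d) : ℝ :=
  ∫ t in (0 : ℝ)..R, Real.exp (-r * t) * f (shear d (ε * t) z)

theorem hasFDerivAt_charIntegral {ε r R : ℝ} {f : E d × E d → ℝ} (hf : ContDiff ℝ 1 f)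
    (hc : HasCompactSupport f) (z : E d × E d) :
    HasFDerivAt (charIntegral ε r R f) (∫ t in (0 : ℝ)..R, Real.exp (-r * t) •
      (fderiv ℝ f (shear d (ε * t) z) ∘L shear d (ε * t))) z := by
  have hsh : Continuous fun t : ℝ => shear d (ε * t) := by unfold shear; fun_prop
  have hf' : Continuous (fderiv ℝ f) := hf.continuous_fderiv (by simp)
  have hfc := hf.continuous
  obtain ⟨C, hC⟩ := (hc.fderiv ℝ).exists_bound_of_continuous hf'
  refine intervalIntegral.hasFDerivAt_integral_of_dominated_of_fderiv_le
    (F := fun z t => Real.exp (-r * t) * f (shear d (ε * t) z))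
    (F' := fun z t => Real.exp (-r * t) • (fderiv ℝ f (shear d (ε * t) z) ∘L shear d (ε * t)))
    (bound := fun t => Real.exp (-r * t) * (C * ‖shear d (ε * t)‖))
    Filter.univ_mem ?_ ?_ ?_ ?_ ?_ ?_
  · exact Filter.Eventually.of_forall fun z =>
      (by fun_prop : Continuous fun t : ℝ =>
        Real.exp (-r * t) * f (shear d (ε * t) z)).aestronglyMeasurable
  · exact (by fun_prop : Continuous fun t : ℝ =>
        Real.exp (-r * t) * f (shear d (ε * t) z)).intervalIntegrable _ _
  · exact (by fun_prop : Continuous fun t : ℝ => Real.exp (-r * t) •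
      (fderiv ℝ f (shear d (ε * t) z) ∘L shear d (ε * t))).aestronglyMeasurable
  · refine Filter.Eventually.of_forall fun t _ z _ => ?_
    rw [norm_smul, Real.norm_eq_abs, Real.abs_exp]
    gcongr
    exact (ContinuousLinearMap.opNorm_comp_le _ _).trans (by gcongr; exact hC _)
  · exact (by fun_prop : Continuous fun t : ℝ =>
      Real.exp (-r * t) * (C * ‖shear d (ε * t)‖)).intervalIntegrable _ _
  · refine Filter.Eventually.of_forall fun t _ z _ => ?_
    exact (((hf.differentiable (by simp) (shear d (ε * t) z)).hasFDerivAt.comp z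
      (shear d (ε * t)).hasFDerivAt).const_smul (Real.exp (-r * t)))

theorem contDiff_charIntegral {ε r R : ℝ} {f : E d × E d → ℝ} (hf : ContDiff ℝ 1 f)
    (hc : HasCompactSupport f) : ContDiff ℝ 1 (charIntegral ε r R f) := by
  have hsh : Continuous fun t : ℝ => shear d (ε * t) := by unfold shear; fun_prop
  have hf' : Continuous (fderiv ℝ f) := hf.continuous_fderiv (by simp)
  refine contDiff_one_iff_hasFDerivAt.2 ⟨_, ?_, fun z => hasFDerivAt_charIntegral hf hc z⟩
  refine intervalIntegral.continuous_parametric_intervalIntegral_of_continuous' ?_ _ _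
  have h2 : Continuous fun p : (E d × E d) × ℝ => shear d (ε * p.2) := hsh.comp continuous_snd
  have h3 : Continuous fun p : (E d × E d) × ℝ => shear d (ε * p.2) p.1 :=
    h2.clm_apply continuous_fst
  exact (by fun_prop : Continuous fun p : (E d × E d) × ℝ => Real.exp (-r * p.2)).smul
    ((hf'.comp h3).clm_comp h2)

/-- The `t`-derivative of `exp(-r t) f(x - ε t s, s)` is minus the integrand of the left side. The
fundamental theorem leaves `f` at `t = 0`, since the endpoint `t = R` contributes nothing. -/
theorem transportDeriv_charIntegral {ε r R : ℝ} {f : E d × E d → ℝ} (hf : ContDiff ℝ 1 f)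
    (hc : HasCompactSupport f) (z : E d × Sph d)
    (hR : f (shear d (ε * R) (amb z)) = 0) :
    ε * transportDeriv (charIntegral ε r R f) z + r * charIntegral ε r R f (amb z)
      = f (amb z) := by
  have hsh : Continuous fun t : ℝ => shear d (ε * t) := by unfold shear; fun_prop
  have hf' : Continuous (fderiv ℝ f) := hf.continuous_fderiv (by simp)
  have hfc := hf.continuous
  have e1 : transportDeriv (charIntegral ε r R f) z =
      ∫ t in (0 : ℝ)..R, Real.exp (-r * t) *
        fderiv ℝ f (shear d (ε * t) (amb z)) ((z.2 : E d), 0) := by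
    rw [transportDeriv, (hasFDerivAt_charIntegral hf hc (amb z)).fderiv,
      ContinuousLinearMap.intervalIntegral_apply]
    · simp [shear_apply]
    · exact (by fun_prop : Continuous fun t : ℝ => Real.exp (-r * t) •
        (fderiv ℝ f (shear d (ε * t) (amb z)) ∘L shear d (ε * t))).intervalIntegrable _ _
  have hG : ∀ t : ℝ, HasDerivAt (fun t : ℝ => Real.exp (-r * t) * f (shear d (ε * t) (amb z)))
      (-(ε * (Real.exp (-r * t) * fderiv ℝ f (shear d (ε * t) (amb z)) ((z.2 : E d), 0))
        + r * (Real.exp (-r * t) * f (shear d (ε * t) (amb z))))) t := by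
    intro t
    have h1 : HasDerivAt (fun t : ℝ => Real.exp (-r * t)) (Real.exp (-r * t) * -r) t := by
      simpa using ((hasDerivAt_id t).const_mul (-r)).exp
    have h2 : HasDerivAt (fun t : ℝ => shear d (ε * t) (amb z))
        (-ε • ((z.2 : E d), (0 : E d))) t := by
      have : (fun t : ℝ => shear d (ε * t) (amb z)) =
          fun t : ℝ => ((z.1 + t • (-ε • (z.2 : E d)), (z.2 : E d)) : E d × E d) := by
        funext t
        rw [shear_apply]
        simp only [amb, sub_eq_add_neg, smul_smul, neg_smul, smul_neg, mul_comm t]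
      rw [this]
      have h3 : HasDerivAt (fun t : ℝ => z.1 + t • (-ε • (z.2 : E d))) (-ε • (z.2 : E d)) t := by
        simpa using ((hasDerivAt_id t).smul_const (-ε • (z.2 : E d))).const_add z.1
      simpa using h3.prodMk (hasDerivAt_const t (z.2 : E d))
    have h4 := (hf.differentiable (by simp) (shear d (ε * t) (amb z))).hasFDerivAt.comp_hasDerivAt
      t h2
    refine (h1.mul h4).congr_deriv ?_
    rw [map_smul, smul_eq_mul, Function.comp_apply]
    ring
  have hcont : Continuous fun t : ℝ =>
      Real.exp (-r * t) * fderiv ℝ f (shear d (ε * t) (amb z)) ((z.2 : E d), 0) := by fun_prop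
  have hcont' : Continuous fun t : ℝ => Real.exp (-r * t) * f (shear d (ε * t) (amb z)) := by
    fun_prop
  have hftc := intervalIntegral.integral_eq_sub_of_hasDerivAt (a := 0) (b := R) (fun t _ => hG t)
    ((((hcont.const_mul ε).add (hcont'.const_mul r)).neg).intervalIntegrable _ _)
  rw [intervalIntegral.integral_neg, intervalIntegral.integral_add,
    intervalIntegral.integral_const_mul, intervalIntegral.integral_const_mul, ← e1, hR] at hftc
  · have h0 : shear d (ε * 0) (amb z) = amb z := by rw [shear_apply]; simp
    rw [h0] at hftc
    simp only [mul_zero, Real.exp_zero, one_mul, zero_sub, neg_inj] at hftc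
    exact hftc
  · exact (hcont.const_mul ε).intervalIntegrable _ _
  · exact (hcont'.const_mul r).intervalIntegrable _ _

theorem IsTest.eq_zero_of_notMem {f : E d × E d → ℝ} (hf : IsTest D f) {z : E d × E d}
    (hz : z.1 ∉ D) : f z = 0 :=
  image_eq_zero_of_notMem_tsupport fun h => hz (hf.2.2 h).1

/-- The damped transport equation with a test function on the right is solved by a `C¹` function
that vanishes on the entry part of the boundary. -/
theorem exists_transport_solution (ho : IsOpen D) (hb : Bornology.IsBounded D) {ε : ℝ}
    (hε : |ε| = 1) (r : ℝ) {f : E d × E d → ℝ} (hf : IsTest D f) :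
    ∃ u : E d × E d → ℝ, ContDiff ℝ 1 u ∧ (∀ z ∈ entrySet D ε, u (amb z) = 0) ∧
      ∀ z : E d × Sph d, z.1 ∈ D → ε * transportDeriv u z + r * u (amb z) = f (amb z) := by
  have hf1 : ContDiff ℝ 1 f := hf.1.of_le (by simp)
  -- Beyond the diameter, every characteristic started in `D` has left it, so `f` vanishes at the
  -- upper endpoint.
  set R := Metric.diam D + 1 with hRdef
  have hR : 0 ≤ R := by positivity
  refine ⟨charIntegral ε r R f, contDiff_charIntegral hf1 hf.2.1, ?_, fun z hz =>
    transportDeriv_charIntegral hf1 hf.2.1 z ?_⟩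
  -- From an entry point the backward ray stays on the outer side of the supporting hyperplane,
  -- never meeting `D`, so the integrand is zero.
  · rintro ⟨x, s⟩ ⟨n, hn, hs⟩
    refine (intervalIntegral.integral_congr (g := fun _ => (0 : ℝ)) fun t ht => ?_).trans
      intervalIntegral.integral_zero
    rw [uIcc_of_le hR] at ht
    have : f (shear d (ε * t) (amb (x, s))) = 0 := by
      refine hf.eq_zero_of_notMem fun hmem => ?_
      rw [shear_apply] at hmem
      have := hn.inner_neg ho hmem
      simp only [amb, sub_sub_cancel_left, inner_neg_left, inner_smul_left] at this
      simp at this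
      nlinarith [ht.1]
    simp only [this, mul_zero]
  · refine hf.eq_zero_of_notMem fun hmem => ?_
    rw [shear_apply] at hmem
    have := Metric.dist_le_diam_of_mem hb hz hmem
    have hs : ‖(z.2 : E d)‖ = 1 := by simp
    rw [dist_eq_norm] at this
    simp only [amb, sub_sub_cancel, norm_smul, norm_mul, Real.norm_eq_abs, hε, hs,
      abs_of_nonneg hR, one_mul, mul_one] at this
    linarith

/-! ### Accretivity and dense range on the closures `H_{0,±}`. -/

section Spaces

variable {Γ : Set (E d × Sph d)}

/-- `fn` as a continuous linear map. -/
def fnL (D : Set (E d)) : H D →L[ℝ] L2 D := WithLp.fstL 2 ℝ (L2 D) (L2 D) ∘L (H D).subtypeL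

/-- `tderiv` as a continuous linear map. -/
def tderivL (D : Set (E d)) : H D →L[ℝ] L2 D := WithLp.sndL 2 ℝ (L2 D) (L2 D) ∘L (H D).subtypeL

theorem fnL_apply (v : H D) : fnL D v = fn v := rfl

theorem tderivL_apply (v : H D) : tderivL D v = tderiv v := rfl

theorem inner_tderiv_fn_nonneg (ho : IsOpen D) (hb : Bornology.IsBounded D) (hD : Convex ℝ D)
    {ε : ℝ} {v : H D} (hv : v ∈ (C1Vanishing D (entrySet D ε)).topologicalClosure) :
    0 ≤ ⟪ε • tderiv v, fn v⟫ := by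
  have hcl : IsClosed {v : H D | 0 ≤ ⟪ε • tderivL D v, fnL D v⟫} :=
    isClosed_le continuous_const
      (((tderivL D).continuous.const_smul ε).inner (fnL D).continuous)
  refine closure_minimal (s := (C1Vanishing D (entrySet D ε) : Set (H D))) ?_ hcl hv
  rintro p ⟨φ, h1, h2, h3⟩
  refine (integral_transportDeriv_mul_nonneg ho hb hD h1 h2).trans_eq ?_
  rw [inner_eq_integral]
  refine integral_congr_ae ?_
  filter_upwards [tderiv_ae_eq ho hb h1 h3, h3, Lp.coeFn_smul ε (tderivL D p)] with z hz1 hz2 hz3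
  rw [hz3, Pi.smul_apply, tderivL_apply, hz1, fnL_apply, fn, hz2, smul_eq_mul, mul_comm]

theorem ofC1_mem_closure (ho : IsOpen D) (hb : Bornology.IsBounded D) {φ : E d × E d → ℝ}
    (h : ContDiff ℝ 1 φ) (hz : ∀ z ∈ Γ, φ (amb z) = 0) :
    ofC1 ho hb h ∈ (C1Vanishing D Γ).topologicalClosure :=
  Submodule.le_topologicalClosure _ ⟨φ, h, hz, fn_ofC1 ho hb h⟩

theorem denseRange_tderiv_add (ho : IsOpen D) (hb : Bornology.IsBounded D) {ε : ℝ}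
    (hε : |ε| = 1) (hΓ : Γ = entrySet D ε) (r : ℝ) :
    DenseRange fun x : (C1Vanishing D Γ).topologicalClosure => ε • tderiv x.1 + r • fn x.1 := by
  refine (dense_testL2 ho hb).mono ?_
  rintro _ ⟨f, hf, rfl⟩
  obtain ⟨u, hu1, hu2, hu3⟩ := exists_transport_solution ho hb hε r hf
  refine ⟨⟨ofC1 ho hb hu1, ofC1_mem_closure ho hb hu1 (hΓ ▸ hu2)⟩, ?_⟩
  change ε • tderiv (ofC1 ho hb hu1) + r • fn (ofC1 ho hb hu1) = testL2 hf
  refine Lp.ext ?_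
  filter_upwards [Lp.coeFn_add (ε • tderiv (ofC1 ho hb hu1)) (r • fn (ofC1 ho hb hu1)),
    Lp.coeFn_smul ε (tderiv (ofC1 ho hb hu1)), Lp.coeFn_smul r (fn (ofC1 ho hb hu1)),
    tderiv_ofC1 ho hb hu1, fn_ofC1 ho hb hu1, hf.memLp.coeFn_toLp, ae_fst_mem ho]
    with z h1 h2 h3 h4 h5 h6 h7
  rw [testL2, h6, h1, Pi.add_apply, h2, h3, Pi.smul_apply, Pi.smul_apply, h4, h5, smul_eq_mul,
    smul_eq_mul, hu3 z h7]

/-- Testing the weak derivative against `φ` itself equates the pairing with its own negative. -/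
theorem inner_tderiv_ofC1_of_isTest (ho : IsOpen D) (hb : Bornology.IsBounded D)
    {φ : E d × E d → ℝ} (hφ : IsTest D φ) (h : ContDiff ℝ 1 φ) :
    ⟪tderiv (ofC1 ho hb h), fn (ofC1 ho hb h)⟫ = 0 := by
  have h1 := (ofC1 ho hb h).2 φ hφ
  have h2 : ∫ z, fn (ofC1 ho hb h) z * transportDeriv φ z ∂(phaseMeasure D) =
      ⟪tderiv (ofC1 ho hb h), fn (ofC1 ho hb h)⟫ := by
    rw [real_inner_comm, inner_eq_integral]
    refine integral_congr_ae ?_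
    filter_upwards [tderiv_ofC1 ho hb h] with z hz
    rw [hz]
  have h3 : ∫ z, tderiv (ofC1 ho hb h) z * φ (amb z) ∂(phaseMeasure D) =
      ⟪tderiv (ofC1 ho hb h), fn (ofC1 ho hb h)⟫ := by
    rw [inner_eq_integral]
    refine integral_congr_ae ?_
    filter_upwards [fn_ofC1 ho hb h] with z hz
    rw [hz]
  change ∫ z, fn (ofC1 ho hb h) z * transportDeriv φ z ∂(phaseMeasure D) =
    -∫ z, tderiv (ofC1 ho hb h) z * φ (amb z) ∂(phaseMeasure D) at h1
  linarith

end Spaces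

end Transport

/-! ### Multiplication and scattering as bounded operators on `L₂`. -/

section Operators

theorem exists_mul_operator {Z : Type*} [MeasurableSpace Z] {μ : Measure Z} {σ : Z → ℝ}
    (hσ : AEStronglyMeasurable σ μ) {M : ℝ≥0} (hb : ∀ᵐ z ∂μ, |σ z| ≤ M) :
    ∃ T : Lp ℝ 2 μ →L[ℝ] Lp ℝ 2 μ, (∀ u, T u =ᵐ[μ] fun z => σ z * u z) ∧
      ∀ u, ‖T u‖ ≤ M * ‖u‖ := by
  have hle : ∀ u : Lp ℝ 2 μ, ∀ᵐ z ∂μ, ‖σ z * u z‖ ≤ M * ‖u z‖ := fun u => by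
    filter_upwards [hb] with z hz
    rw [norm_mul, Real.norm_eq_abs (σ z)]
    gcongr
  have hm : ∀ u : Lp ℝ 2 μ, MemLp (fun z => σ z * u z) 2 μ := fun u =>
    (Lp.memLp u).of_le_mul (hσ.mul (Lp.memLp u).1) (hle u)
  let T : Lp ℝ 2 μ →ₗ[ℝ] Lp ℝ 2 μ :=
    { toFun := fun u => (hm u).toLp _
      map_add' := fun u v => by
        refine Lp.ext ?_
        filter_upwards [(hm (u + v)).coeFn_toLp, (hm u).coeFn_toLp, (hm v).coeFn_toLp,
          Lp.coeFn_add u v, Lp.coeFn_add ((hm u).toLp _) ((hm v).toLp _)] with z h1 h2 h3 h4 h5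
        rw [h1, h5, Pi.add_apply, h2, h3, h4, Pi.add_apply, mul_add]
      map_smul' := fun c u => by
        refine Lp.ext ?_
        filter_upwards [(hm (c • u)).coeFn_toLp, (hm u).coeFn_toLp,
          Lp.coeFn_smul c u, Lp.coeFn_smul c ((hm u).toLp _)] with z h1 h2 h3 h4
        rw [h1, RingHom.id_apply, h4, Pi.smul_apply, h2, h3, Pi.smul_apply, smul_eq_mul,
          smul_eq_mul]
        ring }
  have hT : ∀ u, ‖T u‖ ≤ M * ‖u‖ := fun u => by
    refine Lp.norm_le_mul_norm_of_ae_le_mul ?_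
    filter_upwards [(hm u).coeFn_toLp, hle u] with z h1 h2
    change ‖(hm u).toLp _ z‖ ≤ _
    rwa [h1]
  exact ⟨T.mkContinuous M hT, fun u => (hm u).coeFn_toLp, hT⟩

variable {X S : Type*} [MeasurableSpace X] [MeasurableSpace S] {μ : Measure X} {ν : Measure S}
  [SFinite μ] [SFinite ν] {K : X × S × S → ℝ}

theorem measurePreserving_rearrange (μ : Measure X) (ν : Measure S) [SFinite μ] [SFinite ν] :
    MeasurePreserving (fun p : (X × S) × S => (p.1.1, (p.2, p.1.2))) ((μ.prod ν).prod ν)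
      (μ.prod (ν.prod ν)) :=
  ((MeasurePreserving.id μ).prod (Measure.measurePreserving_swap (μ := ν) (ν := ν))).comp
    (measurePreserving_prodAssoc μ ν ν)

theorem quasiMeasurePreserving_fst_snd (μ : Measure X) (ν : Measure S) [SFinite μ] [SFinite ν] :
    Measure.QuasiMeasurePreserving (fun p : (X × S) × S => (p.1.1, p.2)) ((μ.prod ν).prod ν)
      (μ.prod ν) :=
  (Measure.quasiMeasurePreserving_fst.comp
    ((measurePreserving_prodAssoc μ ν ν).symm MeasurableEquiv.prodAssoc).quasiMeasurePreserving).comp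
    (measurePreserving_rearrange μ ν).quasiMeasurePreserving

theorem aestronglyMeasurable_kernel_mul
    (hK : AEStronglyMeasurable K (μ.prod (ν.prod ν))) {u : X × S → ℝ}
    (hu : AEStronglyMeasurable u (μ.prod ν)) :
    AEStronglyMeasurable (fun p : (X × S) × S => K (p.1.1, p.2, p.1.2) * u (p.1.1, p.2))
      ((μ.prod ν).prod ν) :=
  (hK.comp_measurePreserving (measurePreserving_rearrange μ ν)).mul
    (hu.comp_quasiMeasurePreserving (quasiMeasurePreserving_fst_snd μ ν))

/-- The Hilbert–Schmidt bound: Cauchy–Schwarz in `s'` for each `s`, then integration in `s`. -/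
theorem lintegral_kernel_mul_sq_le {k : S × S → ℝ} (hk : AEStronglyMeasurable k (ν.prod ν))
    {w : S → ℝ} (hw : AEStronglyMeasurable w ν) :
    ∫⁻ s, (∫⁻ s', ‖k (s', s) * w s'‖ₑ ∂ν) ^ (2 : ℝ) ∂ν ≤
      eLpNorm k 2 (ν.prod ν) ^ (2 : ℝ) * ∫⁻ s', ‖w s'‖ₑ ^ (2 : ℝ) ∂ν := by
  have hk2 : AEMeasurable (fun p : S × S => ‖k p‖ₑ ^ (2 : ℝ)) (ν.prod ν) := hk.enorm.pow_const _
  have hsq : eLpNorm k 2 (ν.prod ν) ^ (2 : ℝ) =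
      ∫⁻ s, ∫⁻ s', ‖k (s', s)‖ₑ ^ (2 : ℝ) ∂ν ∂ν := by
    rw [eLpNorm_eq_lintegral_rpow_enorm_toReal (by norm_num) (by norm_num), ← ENNReal.rpow_mul]
    norm_num
    exact lintegral_prod_symm _ (by simpa using hk2)
  rw [hsq, ← lintegral_mul_const'']
  · refine lintegral_mono_ae ?_
    have hsec : ∀ᵐ s ∂ν, AEStronglyMeasurable (fun s' => k (s', s)) ν :=
      hk.prod_swap.prodMk_left
    filter_upwards [hsec] with s hs
    have h1 := ENNReal.lintegral_mul_le_Lp_mul_Lq ν Real.HolderConjugate.two_two hs.enorm hw.enorm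
    calc (∫⁻ s', ‖k (s', s) * w s'‖ₑ ∂ν) ^ (2 : ℝ)
        = (∫⁻ s', ‖k (s', s)‖ₑ * ‖w s'‖ₑ ∂ν) ^ (2 : ℝ) := by simp_rw [enorm_mul]
      _ ≤ ((∫⁻ s', ‖k (s', s)‖ₑ ^ (2 : ℝ) ∂ν) ^ (1 / (2 : ℝ)) *
          (∫⁻ s', ‖w s'‖ₑ ^ (2 : ℝ) ∂ν) ^ (1 / (2 : ℝ))) ^ (2 : ℝ) := by gcongr; exact h1
      _ = _ := by
        rw [ENNReal.mul_rpow_of_nonneg _ _ (by norm_num), ← ENNReal.rpow_mul,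
          ← ENNReal.rpow_mul]
        norm_num
  · exact hk2.prod_swap.lintegral_prod_right'

theorem lintegral_scatter_sq_le (hK : AEStronglyMeasurable K (μ.prod (ν.prod ν))) {M : ℝ≥0}
    (hb : ∀ᵐ x ∂μ, eLpNorm (fun q => K (x, q)) 2 (ν.prod ν) ≤ M) {u : X × S → ℝ}
    (hu : AEStronglyMeasurable u (μ.prod ν)) :
    ∫⁻ z, (∫⁻ s', ‖K (z.1, s', z.2) * u (z.1, s')‖ₑ ∂ν) ^ (2 : ℝ) ∂(μ.prod ν) ≤
      (M : ℝ≥0∞) ^ (2 : ℝ) * ∫⁻ z, ‖u z‖ₑ ^ (2 : ℝ) ∂(μ.prod ν) := by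
  have hu2 : AEMeasurable (fun p : X × S => ‖u p‖ₑ ^ (2 : ℝ)) (μ.prod ν) :=
    hu.enorm.pow_const _
  rw [lintegral_prod _ ((aestronglyMeasurable_kernel_mul hK hu).enorm.lintegral_prod_right'.pow_const
    _), lintegral_prod _ hu2, ← lintegral_const_mul'' _ hu2.lintegral_prod_right']
  refine lintegral_mono_ae ?_
  filter_upwards [hb, hK.prodMk_left, hu.prodMk_left] with x hx hkx hux
  exact (lintegral_kernel_mul_sq_le (k := fun q => K (x, q)) hkx hux).trans (by gcongr)

/-- Additivity of the Bochner integral in `u` needs integrability of almost every slice, which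
finiteness of the square bound supplies. -/
theorem ae_integrable_kernel_mul (hK : AEStronglyMeasurable K (μ.prod (ν.prod ν))) {M : ℝ≥0}
    (hb : ∀ᵐ x ∂μ, eLpNorm (fun q => K (x, q)) 2 (ν.prod ν) ≤ M) {u : X × S → ℝ}
    (hu : MemLp u 2 (μ.prod ν)) :
    ∀ᵐ z ∂(μ.prod ν), Integrable (fun s' => K (z.1, s', z.2) * u (z.1, s')) ν := by
  have hm := aestronglyMeasurable_kernel_mul hK hu.1
  have hfin : ∫⁻ z, (∫⁻ s', ‖K (z.1, s', z.2) * u (z.1, s')‖ₑ ∂ν) ^ (2 : ℝ) ∂(μ.prod ν) ≠ ⊤ := by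
    refine ((lintegral_scatter_sq_le hK hb hu.1).trans_lt ?_).ne
    refine ENNReal.mul_lt_top (by simp) ?_
    simpa using lintegral_rpow_enorm_lt_top_of_eLpNorm_lt_top (by norm_num) (by norm_num) hu.2
  filter_upwards [ae_lt_top' (hm.enorm.lintegral_prod_right'.pow_const _) hfin, hm.prodMk_left]
    with z hz hz'
  refine ⟨hz', ?_⟩
  by_contra h
  rw [HasFiniteIntegral, not_lt, top_le_iff] at h
  rw [h] at hz
  simp at hz

theorem exists_scatter_operator (hK : AEStronglyMeasurable K (μ.prod (ν.prod ν))) {M : ℝ≥0}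
    (hb : ∀ᵐ x ∂μ, eLpNorm (fun q => K (x, q)) 2 (ν.prod ν) ≤ M) :
    ∃ T : Lp ℝ 2 (μ.prod ν) →L[ℝ] Lp ℝ 2 (μ.prod ν),
      (∀ u, T u =ᵐ[μ.prod ν] fun z => ∫ s', K (z.1, s', z.2) * u (z.1, s') ∂ν) ∧
      ∀ u, ‖T u‖ ≤ M * ‖u‖ := by
  set Φ : (X × S → ℝ) → X × S → ℝ := fun u z => ∫ s', K (z.1, s', z.2) * u (z.1, s') ∂ν with hΦ
  have hnorm : ∀ u : Lp ℝ 2 (μ.prod ν),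
      eLpNorm (Φ u) 2 (μ.prod ν) ≤ M * eLpNorm u 2 (μ.prod ν) := fun u => by
    have h1 := lintegral_scatter_sq_le hK hb (Lp.memLp u).1
    have h2 : ∫⁻ z, ‖Φ u z‖ₑ ^ (2 : ℝ) ∂(μ.prod ν) ≤
        (M : ℝ≥0∞) ^ (2 : ℝ) * ∫⁻ z, ‖u z‖ₑ ^ (2 : ℝ) ∂(μ.prod ν) := by
      refine le_trans (lintegral_mono fun z => ?_) h1
      gcongr
      exact enorm_integral_le_lintegral_enorm _
    rw [eLpNorm_eq_lintegral_rpow_enorm_toReal (by norm_num) (by norm_num),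
      eLpNorm_eq_lintegral_rpow_enorm_toReal (by norm_num) (by norm_num), ENNReal.toReal_ofNat]
    calc (∫⁻ z, ‖Φ u z‖ₑ ^ (2 : ℝ) ∂(μ.prod ν)) ^ (1 / (2 : ℝ))
        ≤ ((M : ℝ≥0∞) ^ (2 : ℝ) * ∫⁻ z, ‖u z‖ₑ ^ (2 : ℝ) ∂(μ.prod ν)) ^ (1 / (2 : ℝ)) := by
          gcongr
      _ = _ := by
        rw [ENNReal.mul_rpow_of_nonneg _ _ (by norm_num), ← ENNReal.rpow_mul]
        norm_num
  have hm : ∀ u : Lp ℝ 2 (μ.prod ν), MemLp (Φ u) 2 (μ.prod ν) := fun u =>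
    ⟨(aestronglyMeasurable_kernel_mul hK (Lp.memLp u).1).integral_prod_right',
      (hnorm u).trans_lt (ENNReal.mul_lt_top ENNReal.coe_lt_top (Lp.memLp u).2)⟩
  have hint : ∀ u : Lp ℝ 2 (μ.prod ν), ∀ᵐ z ∂(μ.prod ν),
      Integrable (fun s' => K (z.1, s', z.2) * u (z.1, s')) ν :=
    fun u => ae_integrable_kernel_mul hK hb (Lp.memLp u)
  -- Identities in `Lp` hold only almost everywhere on the product; by Fubini they hold for almost
  -- every `s'` on almost every slice, as the inner integral requires.
  have hsec : ∀ {f g : X × S → ℝ}, f =ᵐ[μ.prod ν] g →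
      ∀ᵐ z ∂(μ.prod ν), ∀ᵐ s' ∂ν, f (z.1, s') = g (z.1, s') := fun h =>
    Measure.quasiMeasurePreserving_fst.ae (Measure.ae_ae_of_ae_prod h)
  let T : Lp ℝ 2 (μ.prod ν) →ₗ[ℝ] Lp ℝ 2 (μ.prod ν) :=
    { toFun := fun u => (hm u).toLp _
      map_add' := fun u v => by
        refine Lp.ext ?_
        filter_upwards [(hm (u + v)).coeFn_toLp, (hm u).coeFn_toLp, (hm v).coeFn_toLp,
          hsec (Lp.coeFn_add u v), Lp.coeFn_add ((hm u).toLp _) ((hm v).toLp _), hint u, hint v]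
          with z h1 h2 h3 h4 h5 h6 h7
        rw [h1, h5, Pi.add_apply, h2, h3, hΦ]
        simp only
        rw [← integral_add h6 h7]
        refine integral_congr_ae ?_
        filter_upwards [h4] with s' hs'
        rw [hs', Pi.add_apply, mul_add]
      map_smul' := fun c u => by
        refine Lp.ext ?_
        filter_upwards [(hm (c • u)).coeFn_toLp, (hm u).coeFn_toLp,
          hsec (Lp.coeFn_smul c u), Lp.coeFn_smul c ((hm u).toLp _)] with z h1 h2 h3 h4
        rw [h1, RingHom.id_apply, h4, Pi.smul_apply, h2, hΦ, smul_eq_mul]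
        simp only
        rw [← integral_const_mul]
        refine integral_congr_ae ?_
        filter_upwards [h3] with s' hs'
        rw [hs', Pi.smul_apply, smul_eq_mul]
        ring }
  have hT : ∀ u, ‖T u‖ ≤ M * ‖u‖ := fun u => by
    change ‖(hm u).toLp _‖ ≤ _
    rw [Lp.norm_toLp, Lp.norm_def, ← ENNReal.coe_toReal, ← ENNReal.toReal_mul]
    exact ENNReal.toReal_mono
      (ENNReal.mul_lt_top ENNReal.coe_lt_top (Lp.memLp u).2).ne (hnorm u)
  exact ⟨T.mkContinuous M hT, fun u => (hm u).coeFn_toLp, hT⟩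

end Operators

/-! ### Coercivity of `σ - 𝒦` and the two formulations. -/

section Assembly

variable {d : ℕ} {D : Set (E d)} {σ : E d × Sph d → ℝ} {K : E d × Sph d × Sph d → ℝ}
  {Tσ TK : L2 D →L[ℝ] L2 D}

theorem formTwo_eq_inner (hσ : ∀ u : L2 D, Tσ u =ᵐ[phaseMeasure D] fun z => σ z * u z)
    (hK : ∀ u : L2 D, TK u =ᵐ[phaseMeasure D] scatter K u) (u : HZeroMinus D) (v : L2 D) :
    formTwo D σ K u v = ⟪(1 : ℝ) • tderiv u.1 + (Tσ - TK) (fn u.1), v⟫ := by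
  rw [one_smul, sub_apply, add_sub_assoc', inner_sub_left, inner_eq_integral,
    inner_eq_integral, formTwo]
  congr 1
  · refine integral_congr_ae ?_
    filter_upwards [hσ (fn u.1), Lp.coeFn_add (tderiv u.1) (Tσ (fn u.1))] with z h1 h2
    rw [h2, Pi.add_apply, h1]
  · refine integral_congr_ae ?_
    filter_upwards [hK (fn u.1)] with z h1
    rw [h1]

/-- Multiplication by `σ` is symmetric, and scattering moves to the test side through the abstract
adjoint, so no transposed kernel is needed. -/
theorem formOne_eq_inner (hσ : ∀ u : L2 D, Tσ u =ᵐ[phaseMeasure D] fun z => σ z * u z)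
    (hK : ∀ u : L2 D, TK u =ᵐ[phaseMeasure D] scatter K u) (u : L2 D) (v : HZeroPlus D) :
    formOne D σ K u v =
      ⟪u, (-1 : ℝ) • tderiv v.1 + ContinuousLinearMap.adjoint (Tσ - TK) (fn v.1)⟫ := by
  have hs : ⟪Tσ u, fn v.1⟫ = ⟪u, Tσ (fn v.1)⟫ := by
    rw [inner_eq_integral, inner_eq_integral]
    refine integral_congr_ae ?_
    filter_upwards [hσ u, hσ (fn v.1)] with z h1 h2
    rw [h1, h2]
    ring
  rw [inner_add_right, ContinuousLinearMap.adjoint_inner_right, sub_apply,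
    inner_sub_left, hs, neg_one_smul, ← add_sub_assoc, ← inner_add_right, inner_eq_integral,
    inner_eq_integral, formOne]
  congr 1
  · refine integral_congr_ae ?_
    filter_upwards [hσ (fn v.1), Lp.coeFn_add (-tderiv v.1) (Tσ (fn v.1)),
      Lp.coeFn_neg (tderiv v.1)] with z h1 h2 h3
    rw [h2, Pi.add_apply, h1, h3, Pi.neg_apply]
    ring
  · refine integral_congr_ae ?_
    filter_upwards [hK u] with z h1
    rw [h1]

/-- Accretivity of the transport operator on test functions makes the bounded part `σ - 𝒦`
coercive on all of `L₂(D × S)`. -/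
theorem coercive_of_accretive (ho : IsOpen D) (hb : Bornology.IsBounded D)
    (hσ : ∀ u : L2 D, Tσ u =ᵐ[phaseMeasure D] fun z => σ z * u z)
    (hK : ∀ u : L2 D, TK u =ᵐ[phaseMeasure D] scatter K u) {α : ℝ}
    (hacc : ∀ v : HZeroMinus D, α * ‖fn v.1‖ ^ 2 ≤ formTwo D σ K v (fn v.1)) (y : L2 D) :
    α * ‖y‖ ^ 2 ≤ ⟪(Tσ - TK) y, y⟫ := by
  have hcl : IsClosed {y : L2 D | α * ‖y‖ ^ 2 ≤ ⟪(Tσ - TK) y, y⟫} :=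
    isClosed_le (by fun_prop) ((Tσ - TK).continuous.inner continuous_id)
  refine closure_minimal ?_ hcl (dense_testL2 ho hb y)
  rintro _ ⟨φ, hφ, rfl⟩
  have h1 : ContDiff ℝ 1 φ := hφ.1.of_le (by simp)
  -- The support of `φ` lies over the open set `D`, which is disjoint from its frontier, so `φ`
  -- vanishes on the inflow boundary.
  have hmem : ofC1 ho hb h1 ∈ HZeroMinus D := by
    refine ofC1_mem_closure ho hb h1 ?_
    rintro z ⟨n, hn, -⟩
    refine hφ.eq_zero_of_notMem fun hz => ?_
    have hf := hn.1
    rw [ho.frontier_eq] at hf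
    exact hf.2 hz
  have h2 := hacc ⟨_, hmem⟩
  rw [formTwo_eq_inner hσ hK, one_smul, inner_add_left,
    inner_tderiv_ofC1_of_isTest ho hb hφ h1, zero_add] at h2
  exact h2

theorem isClosed_topologicalClosure (Γ : Set (E d × Sph d)) :
    IsClosed ((C1Vanishing D Γ).topologicalClosure : Set (H D)) :=
  Submodule.isClosed_topologicalClosure _

theorem wellPosed_formTwo (ho : IsOpen D) (hD : Convex ℝ D) (hb : Bornology.IsBounded D)
    (hσ : ∀ u : L2 D, Tσ u =ᵐ[phaseMeasure D] fun z => σ z * u z)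
    (hK : ∀ u : L2 D, TK u =ᵐ[phaseMeasure D] scatter K u) {α M : ℝ} (hα : 0 < α) (hM : 0 ≤ M)
    (hA : ∀ y, ‖(Tσ - TK) y‖ ≤ M * ‖y‖) (hco : ∀ y, α * ‖y‖ ^ 2 ≤ ⟪(Tσ - TK) y, y⟫) :
    WellPosed (formTwo D σ K) (1 + (1 + M) / α) ((1 + M) * (1 + (1 + M) / α)) := by
  have h := wellPosed_graph_left (P := HZeroMinus D) (ε := 1) isClosed_H
    (isClosed_topologicalClosure _) (by simp)
    (fun x => inner_tderiv_fn_nonneg ho hb hD (inflow_eq_entrySet (D := D) ▸ x.2))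
    (fun r _ => denseRange_tderiv_add ho hb (by simp) inflow_eq_entrySet r) hA hM hα hco
  have e : formTwo D σ K = fun (u : HZeroMinus D) (v : L2 D) =>
      ⟪(1 : ℝ) • tderiv u.1 + (Tσ - TK) (fn u.1), v⟫ := by
    funext u v
    exact formTwo_eq_inner hσ hK u v
  rw [e]
  exact h

theorem wellPosed_formOne (ho : IsOpen D) (hD : Convex ℝ D) (hb : Bornology.IsBounded D)
    (hσ : ∀ u : L2 D, Tσ u =ᵐ[phaseMeasure D] fun z => σ z * u z)
    (hK : ∀ u : L2 D, TK u =ᵐ[phaseMeasure D] scatter K u) {α M : ℝ} (hα : 0 < α) (hM : 0 ≤ M)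
    (hA : ∀ y, ‖(Tσ - TK) y‖ ≤ M * ‖y‖) (hco : ∀ y, α * ‖y‖ ^ 2 ≤ ⟪(Tσ - TK) y, y⟫) :
    WellPosed (formOne D σ K) (1 + (1 + M) / α) ((1 + M) * (1 + (1 + M) / α)) := by
  -- The adjoint has the same norm and the same quadratic form, so the outflow problem inherits both
  -- constants.
  have hA' : ∀ y, ‖ContinuousLinearMap.adjoint (Tσ - TK) y‖ ≤ M * ‖y‖ := fun y =>
    (ContinuousLinearMap.le_opNorm _ y).trans (by
      gcongr
      rw [LinearIsometryEquiv.norm_map]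
      exact ContinuousLinearMap.opNorm_le_bound _ hM hA)
  have hco' : ∀ y, α * ‖y‖ ^ 2 ≤ ⟪ContinuousLinearMap.adjoint (Tσ - TK) y, y⟫ := fun y => by
    rw [ContinuousLinearMap.adjoint_inner_left, real_inner_comm]
    exact hco y
  have h := wellPosed_graph_right (P := HZeroPlus D) (ε := -1) isClosed_H
    (isClosed_topologicalClosure _) (by simp)
    (fun x => inner_tderiv_fn_nonneg ho hb hD (outflow_eq_entrySet (D := D) ▸ x.2))
    (fun r _ => denseRange_tderiv_add ho hb (by simp) outflow_eq_entrySet r) hA' hM hα hco'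
  have e : formOne D σ K = fun (u : L2 D) (v : HZeroPlus D) =>
      ⟪u, (-1 : ℝ) • tderiv v.1 + ContinuousLinearMap.adjoint (Tσ - TK) (fn v.1)⟫ := by
    funext u v
    exact formOne_eq_inner hσ hK u v
  rw [e]
  exact h

end Assembly

end RadTrans

end

theorem mainTheorem2 (α : ℝ) (hα : 0 < α) (Mσ MK : ℝ≥0) :
    ∃ C κ : ℝ, ∀ (d : ℕ) (_ : 1 ≤ d) (D : Set (RadTrans.E d))
      (_ : IsOpen D) (_ : Convex ℝ D) (_ : Bornology.IsBounded D) (_ : D.Nonempty)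
      (σ : RadTrans.E d × RadTrans.Sph d → ℝ)
      (_ : AEStronglyMeasurable σ (RadTrans.phaseMeasure D))
      (_ : ∀ᵐ z ∂(RadTrans.phaseMeasure D), 0 ≤ σ z ∧ σ z ≤ Mσ)
      (K : RadTrans.E d × RadTrans.Sph d × RadTrans.Sph d → ℝ)
      (_ : AEStronglyMeasurable K ((volume.restrict D).prod
        ((RadTrans.sphereMeasure d).prod (RadTrans.sphereMeasure d))))
      (_ : ∀ᵐ p ∂((volume.restrict D).prod
        ((RadTrans.sphereMeasure d).prod (RadTrans.sphereMeasure d))), 0 ≤ K p)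
      (_ : ∀ᵐ x ∂(volume.restrict D), eLpNorm (fun q => K (x, q)) 2
        ((RadTrans.sphereMeasure d).prod (RadTrans.sphereMeasure d)) ≤ MK)
      (_ : ∀ v : RadTrans.HZeroMinus D,
        α * ‖RadTrans.fn v.1‖ ^ 2 ≤ RadTrans.formTwo D σ K v (RadTrans.fn v.1)),
      RadTrans.WellPosed (RadTrans.formOne D σ K) C κ ∧
      RadTrans.WellPosed (RadTrans.formTwo D σ K) C κ := by
  -- These are the abstract constants at `M = Mσ + MK`, chosen before `d` and `D`.
  refine ⟨1 + (1 + (Mσ + MK)) / α, (1 + (Mσ + MK)) * (1 + (1 + (Mσ + MK)) / α), ?_⟩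
  intro d _ D ho hD hb _ σ hσm hσ K hKm _ hK hacc
  obtain ⟨Tσ, hTσ, hTσn⟩ := RadTrans.exists_mul_operator (M := Mσ) hσm (by
    filter_upwards [hσ] with z hz
    rw [abs_of_nonneg hz.1]
    exact hz.2)
  obtain ⟨TK, hTK, hTKn⟩ : ∃ T : RadTrans.L2 D →L[ℝ] RadTrans.L2 D,
      (∀ u : RadTrans.L2 D, T u =ᵐ[RadTrans.phaseMeasure D] RadTrans.scatter K u) ∧
      ∀ u, ‖T u‖ ≤ MK * ‖u‖ := RadTrans.exists_scatter_operator hKm hK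
  have hA : ∀ y, ‖(Tσ - TK) y‖ ≤ ((Mσ : ℝ) + MK) * ‖y‖ := fun y =>
    (norm_sub_le (Tσ y) (TK y)).trans (by rw [add_mul]; exact add_le_add (hTσn y) (hTKn y))
  have hco := RadTrans.coercive_of_accretive ho hb hTσ hTK hacc
  exact ⟨RadTrans.wellPosed_formOne ho hD hb hTσ hTK hα (by positivity) hA hco,
    RadTrans.wellPosed_formTwo ho hD hb hTσ hTK hα (by positivity) hA hco⟩
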